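/- **Poset.** Let $\mathrm E=\{(0),(ij),(k)\mid 1\le i<j\le 5,\ 1\le k\le 5\}$ (sixteen elements) and $\hat{\mathrm E}=\mathrm E\times\mathbb Z$, with $\alpha^r$ denoting $(\alpha,r)$. Make $\hat{\mathrm E}$ a directed graph whose arrows are, for all $r\in\mathbb Z$, the arrows inside level $r$ $$(0)\to(12)\to(13),\quad (13)\to(14),(23),\quad (14)\to(15),(24),\quad (23)\to(24),\quad (15)\to(25),\quad (24)\to(25),(34),$$ $$(25)\to(35),\quad (34)\to(35),(5),\quad (35)\to(45),(4),\quad (5)\to(4),\quad (45)\to(3),\quad (4)\to(3),\quad (3)\to(2)\to(1)$$ together with $(45)^r\to(0)^{r+1}$, $(3)^r\to(12)^{r+1}$, $(2)^r\to(13)^{r+1}$, $(1)^r\to(23)^{r+1}$. Put $\hat\alpha\le\hat\beta$ if there is a directed path (possibly of length $0$) from $\hat\alpha$ to $\hat\beta$; this is a partial order. For $\hat\delta,\hat\delta'\in\hat{\mathrm E}$ put $[\hat\delta,\hat\delta']=\{\hat\alpha\mid\hat\delta\le\hat\alpha\le\hat\delta'\}$, a finite set. **Quadrics.** For variables $\lambda=\lambda^{(0)}$,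 $w_{ij}=\lambda^{(ij)}$, $p_k=\lambda^{(k)}$ let $$\begin{aligned} \Gamma^{1}&=\lambda p_1+w_{25}w_{34}-w_{24}w_{35}+w_{23}w_{45}, & \Gamma^{1^*}&=-p_2w_{12}+p_3w_{13}-p_4w_{14}+p_5w_{15},\\ \Gamma^{2}&=-\lambda p_2-w_{15}w_{34}+w_{14}w_{35}-w_{13}w_{45}, & \Gamma^{2^*}&=-p_1w_{12}+p_3w_{23}-p_4w_{24}+p_5w_{25},\\ \Gamma^{3}&=\lambda p_3+w_{15}w_{24}-w_{14}w_{25}+w_{12}w_{45}, & \Gamma^{3^*}&=-p_1w_{13}+p_2w_{23}-p_4w_{34}+p_5w_{35},\\ \Gamma^{4}&=-\lambda p_4-w_{15}w_{23}+w_{13}w_{25}-w_{12}w_{35}, & \Gamma^{4^*}&=-p_1w_{14}+p_2w_{24}-p_3w_{34}+p_5w_{45},\\ \Gamma^{5}&=\lambda p_5+w_{14}w_{23}-w_{13}w_{24}+w_{12}w_{34}, & \Gamma^{5^*}&=-p_1w_{15}+p_2w_{25}-p_3w_{35}+p_4w_{45}. \end{aligned}$$ These are the components of the $\mathrm{Spin}(10)$-equivariant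 map $\mathrm{Sym}^2S\to V$; their common zero locus in $\mathbb C^{16}$ is the cone of pure spinors. **Algebras.** Let $P_{\hat\delta}^{\hat\delta'}=\mathbb C[\lambda^{\hat\alpha}\mid\hat\alpha\in[\hat\delta,\hat\delta']]$ and, for $\alpha\in\mathrm E$, $\lambda^\alpha(z)=\sum_{l:\,\alpha^l\in[\hat\delta,\hat\delta']}\lambda^{\alpha^l}z^l$. For $\mathbf s\in\{1,\dots,5,1^*,\dots,5^*\}$ and $l\in\mathbb Z$ let $\Gamma^{\mathbf s^l}\in P_{\hat\delta}^{\hat\delta'}$ be the coefficient of $z^l$ in $\Gamma^{\mathbf s}(\lambda(z))$. Let $A_{\hat\delta}^{\hat\delta'}$ be the quotient of $P_{\hat\delta}^{\hat\delta'}$ by the ideal generated by all $\Gamma^{\mathbf s^l}$. **Corollary.** For every interval $[\hat\delta,\hat\delta']$ of $\hat{\mathrm E}$, the algebra $A_{\hat\delta}^{\hat\delta'}$ is an algebra with straightened law over $\mathbb C$ on the generators $\lambda^{\hat\alpha}$, $\hat\alpha\in[\hat\delta,\hat\delta']$. That is: 1. The standard monomials $\lambda^{\hat\alpha_1}\cdots\lambda^{\hat\alpha_n}$,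 $n\ge 0$, labelled by the sequences $\hat\alpha_1\le\dots\le\hat\alpha_n$ in $[\hat\delta,\hat\delta']$, form a basis of the vector space $A_{\hat\delta}^{\hat\delta'}$. 2. If $\hat\alpha,\hat\beta\in[\hat\delta,\hat\delta']$ are incomparable, then every standard monomial $\lambda^{\hat\gamma_1}\cdots\lambda^{\hat\gamma_k}$, $\hat\gamma_1\le\dots\le\hat\gamma_k$, that occurs with nonzero coefficient in the expression of $\lambda^{\hat\alpha}\lambda^{\hat\beta}$ through the basis of standard monomials has $k\ge 1$ and satisfies $\hat\gamma_1\le\hat\alpha$ and $\hat\gamma_1\le\hat\beta$. Moreover, the defining relations are straightening relations. For every pair of incomparable elements (clutter) $\hat\alpha,\hat\beta\in[\hat\delta,\hat\delta']$, the meet $\hat\alpha\wedge\hat\beta$ and the join $\hat\alpha\vee\hat\beta$ exist in $\hat{\mathrm E}$ and lie in $[\hat\delta,\hat\delta']$, and some $\Gamma^{\mathbf s^l}$ is, up to an overall sign, of the form $$\lambda^{\hat\alpha}\lambda^{\hat\beta}\pm\lambda^{\hat\alpha\wedge\hat\beta}\lambda^{\hat\alpha\vee\hat\beta}+\sum\pm\lambda^{\hat\gamma}\lambda^{\hat\gamma'},$$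 where the sum is over a finite set of pairs $(\hat\gamma,\hat\gamma')$ in $[\hat\delta,\hat\delta']$ with $\hat\gamma<\hat\alpha\wedge\hat\beta$ and $\hat\gamma'>\hat\alpha\vee\hat\beta$. Conversely, every $\Gamma^{\mathbf s^l}$ is either $0$ or of this form for some incomparable $\hat\alpha,\hat\beta\in[\hat\delta,\hat\delta']$. -/

import Mathlib

/-! ### The poset of affine spinor weights -/

/-- The sixteen weights of the half-spin representation of `Spin(10)` on the even exterior algebra
of a space with basis `v₁, …, v₅`: the weight `(0)` of `1` (written `o`), the weight `(ij)` of
`vᵢ ∧ vⱼ` (written `wij`), and the weight `(k)` of `v₁ ∧ ⋯ v̂ₖ ⋯ ∧ v₅` (written `pk`). -/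
inductive SpinorWeight : Type
  | o
  | w12 | w13 | w14 | w15 | w23 | w24 | w25 | w34 | w35 | w45
  | p1 | p2 | p3 | p4 | p5
  deriving DecidableEq

namespace SpinorWeight

instance : Fintype SpinorWeight where
  elems := {o, w12, w13, w14, w15, w23, w24, w25, w34, w35, w45, p1, p2, p3, p4, p5}
  complete a := by cases a <;> decide

/-- The targets of the arrows starting at a given vertex of the finite Hasse diagram. -/
def succ : SpinorWeight → List SpinorWeight
  | o => [w12]
  | w12 => [w13]
  | w13 => [w14, w23]
  | w14 => [w15, w24]
  | w23 => [w24]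
  | w15 => [w25]
  | w24 => [w25, w34]
  | w25 => [w35]
  | w34 => [w35, p5]
  | w35 => [w45, p4]
  | p5 => [p4]
  | w45 => [p3]
  | p4 => [p3]
  | p3 => [p2]
  | p2 => [p1]
  | p1 => []

/-- The targets (to be placed on level `r + 1`) of the additional arrows that start at a given
vertex on level `r` of the infinite Hasse diagram. -/
def succUp : SpinorWeight → List SpinorWeight
  | w45 => [o]
  | p3 => [w12]
  | p2 => [w13]
  | p1 => [w23]
  | _ => []

/-- The length of a directed path from `(0)` to the given weight. -/
def ht : SpinorWeight → ℤ
  | o => 0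
  | w12 => 1
  | w13 => 2
  | w14 => 3
  | w23 => 3
  | w15 => 4
  | w24 => 4
  | w25 => 5
  | w34 => 5
  | w35 => 6
  | p5 => 6
  | w45 => 7
  | p4 => 7
  | p3 => 8
  | p2 => 9
  | p1 => 10

theorem ht_succ (a b : SpinorWeight) : b ∈ succ a → b.ht = a.ht + 1 := by
  revert a b; decide

theorem ht_succUp (a b : SpinorWeight) : b ∈ succUp a → b.ht + 8 = a.ht + 1 := by
  revert a b; decide

theorem ht_bounds (a : SpinorWeight) : 0 ≤ a.ht ∧ a.ht ≤ 10 := by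
  revert a; decide

end SpinorWeight

/-- An element `αʳ = (α, r)` of `Ê = E × ℤ`. -/
@[ext]
structure AffineWeight : Type where
  /-- the spinor weight `α` -/
  weight : SpinorWeight
  /-- the level `r` -/
  level : ℤ

namespace AffineWeight

/-- The arrows `a → b` of the infinite directed graph `Ê`. -/
def Arrow (a b : AffineWeight) : Prop :=
  (b.level = a.level ∧ b.weight ∈ a.weight.succ) ∨
    (b.level = a.level + 1 ∧ b.weight ∈ a.weight.succUp)

/-- The height function on `Ê`, which every arrow raises by one. -/
def ht (a : AffineWeight) : ℤ := 8 * a.level + a.weight.ht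

theorem Arrow.ht_eq {a b : AffineWeight} (h : Arrow a b) : b.ht = a.ht + 1 := by
  rcases h with ⟨h₁, h₂⟩ | ⟨h₁, h₂⟩
  · have := SpinorWeight.ht_succ _ _ h₂
    simp only [ht]; omega
  · have := SpinorWeight.ht_succUp _ _ h₂
    simp only [ht]; omega

theorem eq_or_ht_lt {a b : AffineWeight} (h : Relation.ReflTransGen Arrow a b) :
    a = b ∨ a.ht < b.ht := by
  induction h with
  | refl => exact Or.inl rfl
  | tail _ hbc ih =>
    right
    have := hbc.ht_eq
    rcases ih with rfl | ih <;> omega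

/-- `a ≤ b` if there is a directed path from `a` to `b`. -/
instance : PartialOrder AffineWeight where
  le := Relation.ReflTransGen Arrow
  le_refl _ := Relation.ReflTransGen.refl
  le_trans _ _ _ := Relation.ReflTransGen.trans
  le_antisymm a b hab hba := by
    rcases eq_or_ht_lt hab with h | h
    · exact h
    · rcases eq_or_ht_lt hba with h' | h'
      · exact h'.symm
      · omega

theorem ht_mono {a b : AffineWeight} (h : a ≤ b) : a.ht ≤ b.ht := by
  rcases eq_or_ht_lt h with rfl | h
  · exact le_rfl
  · exact h.le

theorem finite_Icc (a b : AffineWeight) : (Set.Icc a b).Finite := by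
  refine (((Set.finite_univ (α := SpinorWeight)).prod
    (Set.finite_Icc (a.level - 2) (b.level + 2))).image
      (fun p => AffineWeight.mk p.1 p.2)).subset ?_
  rintro x ⟨hax, hxb⟩
  refine ⟨(x.weight, x.level), ⟨Set.mem_univ _, ?_⟩, rfl⟩
  have h₁ := ht_mono hax
  have h₂ := ht_mono hxb
  have h₃ := SpinorWeight.ht_bounds a.weight
  have h₄ := SpinorWeight.ht_bounds b.weight
  have h₅ := SpinorWeight.ht_bounds x.weight
  simp only [ht] at h₁ h₂
  constructor <;> dsimp only <;> omega

noncomputable instance : LocallyFiniteOrder AffineWeight :=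
  LocallyFiniteOrder.ofFiniteIcc finite_Icc

end AffineWeight

/-! ### The quadrics and the algebras of intervals -/

/-- The ten weights of the vector representation of `SO(10)`: `vi` is the index `i` and `ui` is the
index `i^*`. -/
inductive VectorWeight : Type
  | v1 | v2 | v3 | v4 | v5
  | u1 | u2 | u3 | u4 | u5
  deriving DecidableEq

open SpinorWeight in
/-- The ten quadratic forms `Γ^s` on the spinor representation (the components of the
`Spin(10)`-equivariant map `Sym² S → V`), evaluated at a spinor with coordinates `x α` in a
commutative ring.  Their common zero set is the cone of pure spinors. -/
def gammaQuadric {R : Type*} [CommRing R] (s : VectorWeight) (x : SpinorWeight → R) : R :=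
  match s with
  | .v1 => x o * x p1 + x w25 * x w34 - x w24 * x w35 + x w23 * x w45
  | .v2 => -(x o * x p2) - x w15 * x w34 + x w14 * x w35 - x w13 * x w45
  | .v3 => x o * x p3 + x w15 * x w24 - x w14 * x w25 + x w12 * x w45
  | .v4 => -(x o * x p4) - x w15 * x w23 + x w13 * x w25 - x w12 * x w35
  | .v5 => x o * x p5 + x w14 * x w23 - x w13 * x w24 + x w12 * x w34
  | .u1 => -(x p2 * x w12) + x p3 * x w13 - x p4 * x w14 + x p5 * x w15
  | .u2 => -(x p1 * x w12) + x p3 * x w23 - x p4 * x w24 + x p5 * x w25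
  | .u3 => -(x p1 * x w13) + x p2 * x w23 - x p4 * x w34 + x p5 * x w35
  | .u4 => -(x p1 * x w14) + x p2 * x w24 - x p3 * x w34 + x p5 * x w45
  | .u5 => -(x p1 * x w15) + x p2 * x w25 - x p3 * x w35 + x p4 * x w45

/-- The polynomial algebra on the generators `λ^a`, `a ∈ [d, d']`. -/
abbrev IntervalPoly (d d' : AffineWeight) : Type := MvPolynomial (Set.Icc d d') ℂ

/-- The generating function `λ^α(z) = ∑ λ^{αˡ} zˡ`, the sum being over all `l` with
`αˡ ∈ [d, d']`. -/
noncomputable def spinorSeries (d d' : AffineWeight) (α : SpinorWeight) :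
    LaurentPolynomial (IntervalPoly d d') :=
  ∑ a : Set.Icc d d', if a.1.weight = α then
    LaurentPolynomial.C (MvPolynomial.X a) * LaurentPolynomial.T a.1.level else 0

/-- The affinized quadric `Γ^{sˡ}`: the coefficient of `zˡ` in `Γ^s(λ(z))`. -/
noncomputable def affineQuadric (d d' : AffineWeight) (s : VectorWeight) (l : ℤ) :
    IntervalPoly d d' :=
  (gammaQuadric s (spinorSeries d d')).coeff l

/-- The ideal generated by all the affinized quadrics. -/
noncomputable def quadricIdeal (d d' : AffineWeight) : Ideal (IntervalPoly d d') :=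
  Ideal.span (Set.range fun t : VectorWeight × ℤ => affineQuadric d d' t.1 t.2)

/-- The algebra `A_d^{d'}`. -/
abbrev IntervalAlgebra (d d' : AffineWeight) : Type := IntervalPoly d d' ⧸ quadricIdeal d d'

/-- The generator `λ^a` of `A_d^{d'}`. -/
noncomputable def intervalGenerator (d d' : AffineWeight) (a : Set.Icc d d') :
    IntervalAlgebra d d' :=
  Ideal.Quotient.mk (quadricIdeal d d') (MvPolynomial.X a)

/-! ### Straightened laws -/

/-- The finite weakly increasing sequences `α₁ ≤ ⋯ ≤ αₙ` (`n ≥ 0`) in a poset. -/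
abbrev Multichain (H : Type*) [PartialOrder H] : Type _ := {l : List H // l.Pairwise (· ≤ ·)}

/-- The standard monomial `τ^{α₁} ⋯ τ^{αₙ}` of the chain `α₁ ≤ ⋯ ≤ αₙ`. -/
def standardMonomial {H A : Type*} [PartialOrder H] [CommRing A] (τ : H → A)
    (l : Multichain H) : A :=
  (l.1.map τ).prod

/-- `A` is an algebra with straightened law over `R`, on generators `τ` labelled by the
poset `H`. -/
structure IsStraightenedLawAlgebra (R : Type*) {H A : Type*} [PartialOrder H] [CommRing R]
    [CommRing A] [Algebra R A] (τ : H → A) : Prop where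
  /-- Standard monomials are linearly independent, … -/
  linearIndependent : LinearIndependent R (standardMonomial τ)
  /-- … and they span `A`, so that they form a basis. -/
  span_eq_top : Submodule.span R (Set.range (standardMonomial τ)) = ⊤
  /-- In the expression of the product of two incomparable generators `τ^α τ^β` through standard
  monomials, every standard monomial that occurs is nonempty, and its smallest label is at most
  `α` and at most `β`. -/
  straightening : ∀ α β : H, ¬ α ≤ β → ¬ β ≤ α →
    ∃ c : Multichain H →₀ R,
      τ α * τ β = c.sum (fun l r => r • standardMonomial τ l) ∧
      ∀ l ∈ c.support, ∃ (γ : H) (l' : List H), l.1 = γ :: l' ∧ γ ≤ α ∧ γ ≤ β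

/-- The quadratic polynomial `q` has, up to an overall sign, the form
`λ^α λ^β ± λ^{α ∧ β} λ^{α ∨ β} + ∑ ± λ^γ λ^γ'`, where the sum is over a finite set of pairs with
`γ < α ∧ β` and `γ' > α ∨ β`; the meet and join are those of `Ê`. -/
def IsStraighteningRelation {d d' : AffineWeight} (q : IntervalPoly d d')
    (α β : Set.Icc d d') : Prop :=
  ∃ m j : Set.Icc d d', IsGLB {α.1, β.1} m.1 ∧ IsLUB {α.1, β.1} j.1 ∧
    ∃ (S : Finset (Set.Icc d d' × Set.Icc d d')) (c : Set.Icc d d' × Set.Icc d d' → ℤˣ)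
      (ε η : ℤˣ),
      (∀ p ∈ S, p.1 < m ∧ j < p.2) ∧
      ε • q = MvPolynomial.X α * MvPolynomial.X β + η • (MvPolynomial.X m * MvPolynomial.X j)
        + ∑ p ∈ S, c p • (MvPolynomial.X p.1 * MvPolynomial.X p.2)

/-! The order on `Ê` is planar: `col` and `row` embed `Ê` in a diagonal strip of ℤ × ℤ, and ≤
becomes the componentwise order (`AffineWeight.le_iff`). Questions about comparability, meets and
joins thus become linear arithmetic.

All monomials of `Γ^{sˡ}` have the same sum of `col` and the same sum of `row`. Exactly one of them
is an incomparable pair, the clutter. Another is its meet times its join, and the remaining ones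
straddle these two (`eq_clutter_or`). Conversely every incomparable pair is the clutter of some
quadric (`exists_clutter`), and of only one (`eq_of_mem_orderings`). This gives the shape of the
relations. On an interval, a monomial that survives truncation forces the clutter into the interval
by convexity, so a quadric whose clutter is not in the interval vanishes
(`clutterMem_of_mem_quadricTerms`).

The basis statement says that the quadrics form a Gröbner basis with the clutters as leading
monomials: the monomials divisible by no clutter are exactly those of multichains. Leading terms are
measured by a quadratic strictly concave function of the height. Among monomials of equal degree and
total height, larger weight means smaller sum of squared heights, and the clutter, whose two heights
are closest together, wins (`ht_le_of_mem_pairs`).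

A Buchberger criterion (`eq_zero_of_mem_span_range`) then asks that overlaps resolve. Coprime
clutters are handled by the Koszul syzygy. Two clutters with a common element are the two terms of
least energy, with cancelling leading coefficients, in the affinization of one of sixteen linear
syzygies of the finite-dimensional quadrics (`exists_syzygy`). Translation by levels makes this a
finite check (`overlap_base`). The syzygies survive truncation to an interval, since they are
polynomial identities evaluated at truncated series, so one check serves all intervals. -/

/-! ### Planar coordinates on `Ê` -/

namespace SpinorWeight

/-- The first coordinate of a weight in the planar embedding of `Ê`. -/
def col : SpinorWeight → ℤ
  | o => 0 | w12 => 0 | w13 => 0 | w23 => 0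
  | w14 => 1 | w24 => 1 | w34 => 1 | p5 => 1
  | w15 => 2 | w25 => 2 | w35 => 2 | p4 => 2
  | w45 => 3 | p3 => 3 | p2 => 3 | p1 => 3

/-- The second coordinate of a weight in the planar embedding of `Ê`. -/
def row : SpinorWeight → ℤ
  | o => -2 | w12 => -1 | w13 => 0 | w23 => 1
  | w14 => 0 | w24 => 1 | w34 => 2 | p5 => 3
  | w15 => 0 | w25 => 1 | w35 => 2 | p4 => 3
  | w45 => 2 | p3 => 3 | p2 => 4 | p1 => 5

end SpinorWeight

namespace AffineWeight

open SpinorWeight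

/-- The first coordinate in the embedding of `Ê` into `ℤ × ℤ`. -/
def col (a : AffineWeight) : ℤ := 4 * a.level + a.weight.col

/-- The second coordinate in the embedding of `Ê` into `ℤ × ℤ`. -/
def row (a : AffineWeight) : ℤ := 4 * a.level + a.weight.row

theorem ht_eq_col_add_row (a : AffineWeight) : a.ht = a.col + a.row + 2 := by
  rcases a with ⟨α, i⟩
  cases α <;> simp only [ht, col, row, SpinorWeight.ht, SpinorWeight.col, SpinorWeight.row] <;>
    omega

theorem eq_iff {a b : AffineWeight} : a = b ↔ a.col = b.col ∧ a.row = b.row := by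
  refine ⟨fun h => by simp [h], ?_⟩
  rcases a with ⟨α, i⟩
  rcases b with ⟨β, j⟩
  cases α <;> cases β <;> simp only [col, row, SpinorWeight.col, SpinorWeight.row, mk.injEq,
    true_and, reduceCtorEq, false_and] <;> omega

theorem Arrow.le_coord {a b : AffineWeight} (h : Arrow a b) :
    a.col ≤ b.col ∧ a.row ≤ b.row := by
  rcases a with ⟨α, i⟩
  rcases b with ⟨β, j⟩
  rcases h with ⟨h₁, h₂⟩ | ⟨h₁, h₂⟩ <;> dsimp only at h₁ h₂ <;> subst h₁ <;>
  cases α <;> simp only [succ, succUp, List.mem_cons, List.not_mem_nil, or_false] at h₂ <;>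
  (try rcases h₂ with rfl | rfl) <;>
  simp only [col, row, SpinorWeight.col, SpinorWeight.row] <;> omega

/-- The image of `Ê` in `ℤ × ℤ` lies in a strip around the diagonal. -/
theorem strip (a : AffineWeight) :
    (a.col % 2 = 0 ∧ a.col - 2 ≤ a.row ∧ a.row ≤ a.col + 1) ∨
      (a.col % 2 = 1 ∧ a.col - 1 ≤ a.row ∧ a.row ≤ a.col + 2) := by
  rcases a with ⟨α, i⟩
  cases α <;> simp only [col, row, SpinorWeight.col, SpinorWeight.row] <;> omega

/-- Arrows are unit steps in one coordinate, and a unit step not available at `a` would leave the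
strip. If every available step overshot `b`, then `b` itself would lie outside the strip. -/
theorem exists_arrow_of_lt {a b : AffineWeight} (h₁ : a.col ≤ b.col) (h₂ : a.row ≤ b.row)
    (h : a ≠ b) : ∃ c, Arrow a c ∧ c.col ≤ b.col ∧ c.row ≤ b.row := by
  have hb := strip b
  have hne : a.col < b.col ∨ a.row < b.row := by
    rw [Ne, eq_iff] at h
    omega
  generalize b.col = x at *
  generalize b.row = y at *
  rcases a with ⟨α, i⟩
  by_contra! hc
  have up : ∀ β ∈ α.succUp, 4 * (i + 1) + β.col ≤ x → y < 4 * (i + 1) + β.row :=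
    fun β hβ => hc ⟨β, i + 1⟩ (Or.inr ⟨rfl, hβ⟩)
  have inner : ∀ β ∈ α.succ, 4 * i + β.col ≤ x → y < 4 * i + β.row :=
    fun β hβ => hc ⟨β, i⟩ (Or.inl ⟨rfl, hβ⟩)
  clear hc
  cases α <;> simp only [succ, succUp, List.forall_mem_cons, List.not_mem_nil, false_implies,
    implies_true, and_true, col, row, SpinorWeight.col, SpinorWeight.row] at * <;> omega

theorem le_iff {a b : AffineWeight} : a ≤ b ↔ a.col ≤ b.col ∧ a.row ≤ b.row := by
  constructor
  · intro h
    induction (h : Relation.ReflTransGen Arrow a b) with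
    | refl => exact ⟨le_rfl, le_rfl⟩
    | tail _ hbc ih =>
      have := hbc.le_coord
      omega
  · rintro ⟨h₁, h₂⟩
    -- Walk from `a` towards `b` one arrow at a time; the height difference counts the arrows that
    -- remain.
    obtain ⟨n, hn⟩ : ∃ n : ℕ, (n : ℤ) = b.ht - a.ht :=
      ⟨(b.ht - a.ht).toNat, Int.toNat_of_nonneg (by simp only [ht_eq_col_add_row]; omega)⟩
    induction n generalizing a with
    | zero =>
      refine le_of_eq (eq_iff.2 ?_)
      simp only [ht_eq_col_add_row] at hn
      omega
    | succ n ih =>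
      obtain ⟨c, hac, hc₁, hc₂⟩ := exists_arrow_of_lt h₁ h₂ (by rintro rfl; omega)
      exact Relation.ReflTransGen.head hac
        (ih hc₁ hc₂ (by rw [hac.ht_eq]; push_cast at hn; omega))

theorem lt_iff {a b : AffineWeight} :
    a < b ↔ (a.col ≤ b.col ∧ a.row ≤ b.row) ∧ (a.col < b.col ∨ a.row < b.row) := by
  rw [lt_iff_le_not_ge, le_iff, le_iff]
  omega

/-- Translation by `r` levels. -/
def shift (r : ℤ) (a : AffineWeight) : AffineWeight := ⟨a.weight, a.level + r⟩

theorem ht_shift (r : ℤ) (a : AffineWeight) : (shift r a).ht = a.ht + 8 * r := by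
  simp only [shift, ht]; ring

end AffineWeight

/-! ### Clutters and quadrics -/

namespace VectorWeight

open SpinorWeight

instance : Fintype VectorWeight where
  elems := {v1, v2, v3, v4, v5, u1, u2, u3, u4, u5}
  complete a := by cases a <;> decide

/-- The pairs of weights that occur in the quadric `Γ^s`. -/
def pairs : VectorWeight → Finset (SpinorWeight × SpinorWeight)
  | v1 => {(o, p1), (w25, w34), (w24, w35), (w23, w45)}
  | v2 => {(o, p2), (w15, w34), (w14, w35), (w13, w45)}
  | v3 => {(o, p3), (w15, w24), (w14, w25), (w12, w45)}
  | v4 => {(o, p4), (w15, w23), (w13, w25), (w12, w35)}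
  | v5 => {(o, p5), (w14, w23), (w13, w24), (w12, w34)}
  | u1 => {(p2, w12), (p3, w13), (p4, w14), (p5, w15)}
  | u2 => {(p1, w12), (p3, w23), (p4, w24), (p5, w25)}
  | u3 => {(p1, w13), (p2, w23), (p4, w34), (p5, w35)}
  | u4 => {(p1, w14), (p2, w24), (p3, w34), (p5, w45)}
  | u5 => {(p1, w15), (p2, w25), (p3, w35), (p4, w45)}

/-- The sign of the monomial of the quadric `Γ^s` whose first factor has the given weight. -/
def sign : VectorWeight → SpinorWeight → ℤˣ
  | v1, w24 => -1
  | v2, o => -1 | v2, w15 => -1 | v2, w13 => -1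
  | v3, w14 => -1
  | v4, o => -1 | v4, w15 => -1 | v4, w12 => -1
  | v5, w13 => -1
  | u1, p2 => -1 | u1, p4 => -1
  | u2, p1 => -1 | u2, p4 => -1
  | u3, p1 => -1 | u3, p4 => -1
  | u4, p1 => -1 | u4, p3 => -1
  | u5, p1 => -1 | u5, p3 => -1
  | _, _ => 1

/-- The only incomparable pair among the monomials of `Γ^{sˡ}`. -/
def clutter (s : VectorWeight) (l : ℤ) : AffineWeight × AffineWeight :=
  match s with
  | v1 => if l % 2 = 0 then (⟨w25, l / 2⟩, ⟨w34, l / 2⟩) else (⟨o, l / 2 + 1⟩, ⟨p1, l / 2⟩)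
  | v2 => if l % 2 = 0 then (⟨w15, l / 2⟩, ⟨w34, l / 2⟩) else (⟨o, l / 2 + 1⟩, ⟨p2, l / 2⟩)
  | v3 => if l % 2 = 0 then (⟨w15, l / 2⟩, ⟨w24, l / 2⟩) else (⟨o, l / 2 + 1⟩, ⟨p3, l / 2⟩)
  | v4 => if l % 2 = 0 then (⟨w15, l / 2⟩, ⟨w23, l / 2⟩) else (⟨o, l / 2 + 1⟩, ⟨p4, l / 2⟩)
  | v5 => if l % 2 = 0 then (⟨w14, l / 2⟩, ⟨w23, l / 2⟩) else (⟨o, l / 2 + 1⟩, ⟨p5, l / 2⟩)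
  | u1 => if l % 2 = 0 then (⟨p5, l / 2⟩, ⟨w15, l / 2⟩) else (⟨p2, l / 2⟩, ⟨w12, l / 2 + 1⟩)
  | u2 => if l % 2 = 0 then (⟨p5, l / 2⟩, ⟨w25, l / 2⟩) else (⟨p1, l / 2⟩, ⟨w12, l / 2 + 1⟩)
  | u3 => if l % 2 = 0 then (⟨p5, l / 2⟩, ⟨w35, l / 2⟩) else (⟨p1, l / 2⟩, ⟨w13, l / 2 + 1⟩)
  | u4 => if l % 2 = 0 then (⟨p5, l / 2⟩, ⟨w45, l / 2⟩) else (⟨p1, l / 2⟩, ⟨w14, l / 2 + 1⟩)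
  | u5 => if l % 2 = 0 then (⟨p4, l / 2⟩, ⟨w45, l / 2⟩) else (⟨p1, l / 2⟩, ⟨w15, l / 2 + 1⟩)

/-- The meet and the join of `clutter s l`. -/
def meetJoin (s : VectorWeight) (l : ℤ) : AffineWeight × AffineWeight :=
  match s with
  | v1 => if l % 2 = 0 then (⟨w24, l / 2⟩, ⟨w35, l / 2⟩) else (⟨w45, l / 2⟩, ⟨w23, l / 2 + 1⟩)
  | v2 => if l % 2 = 0 then (⟨w14, l / 2⟩, ⟨w35, l / 2⟩) else (⟨w45, l / 2⟩, ⟨w13, l / 2 + 1⟩)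
  | v3 => if l % 2 = 0 then (⟨w14, l / 2⟩, ⟨w25, l / 2⟩) else (⟨w45, l / 2⟩, ⟨w12, l / 2 + 1⟩)
  | v4 => if l % 2 = 0 then (⟨w13, l / 2⟩, ⟨w25, l / 2⟩) else (⟨w35, l / 2⟩, ⟨w12, l / 2 + 1⟩)
  | v5 => if l % 2 = 0 then (⟨w13, l / 2⟩, ⟨w24, l / 2⟩) else (⟨w34, l / 2⟩, ⟨w12, l / 2 + 1⟩)
  | u1 => if l % 2 = 0 then (⟨w14, l / 2⟩, ⟨p4, l / 2⟩) else (⟨p3, l / 2⟩, ⟨w13, l / 2 + 1⟩)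
  | u2 => if l % 2 = 0 then (⟨w24, l / 2⟩, ⟨p4, l / 2⟩) else (⟨p3, l / 2⟩, ⟨w23, l / 2 + 1⟩)
  | u3 => if l % 2 = 0 then (⟨w34, l / 2⟩, ⟨p4, l / 2⟩) else (⟨p2, l / 2⟩, ⟨w23, l / 2 + 1⟩)
  | u4 => if l % 2 = 0 then (⟨w34, l / 2⟩, ⟨p3, l / 2⟩) else (⟨p2, l / 2⟩, ⟨w24, l / 2 + 1⟩)
  | u5 => if l % 2 = 0 then (⟨w35, l / 2⟩, ⟨p3, l / 2⟩) else (⟨p2, l / 2⟩, ⟨w25, l / 2 + 1⟩)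

theorem mem_pairs_clutter (s : VectorWeight) (l : ℤ) :
    ((clutter s l).1.weight, (clutter s l).2.weight) ∈ s.pairs := by
  cases s <;> simp only [clutter] <;> split_ifs <;> simp [pairs]

theorem level_clutter (s : VectorWeight) (l : ℤ) :
    (clutter s l).1.level + (clutter s l).2.level = l := by
  cases s <;> simp only [clutter] <;> split_ifs <;> dsimp only <;> omega

theorem mem_pairs_meetJoin (s : VectorWeight) (l : ℤ) :
    ((meetJoin s l).1.weight, (meetJoin s l).2.weight) ∈ s.pairs ∨
      ((meetJoin s l).2.weight, (meetJoin s l).1.weight) ∈ s.pairs := by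
  cases s <;> simp only [meetJoin] <;> split_ifs <;> simp [pairs]

theorem level_meetJoin (s : VectorWeight) (l : ℤ) :
    (meetJoin s l).1.level + (meetJoin s l).2.level = l := by
  cases s <;> simp only [meetJoin] <;> split_ifs <;> dsimp only <;> omega

/-- The clutter of `Γ^{sˡ}` and its meet and join span a rectangle. -/
theorem clutter_rectangle (s : VectorWeight) (l : ℤ) :
    ((clutter s l).1.col < (clutter s l).2.col ∧ (clutter s l).2.row < (clutter s l).1.row ∧
      (meetJoin s l).1.col = (clutter s l).1.col ∧ (meetJoin s l).1.row = (clutter s l).2.row ∧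
      (meetJoin s l).2.col = (clutter s l).2.col ∧ (meetJoin s l).2.row = (clutter s l).1.row) ∨
    ((clutter s l).2.col < (clutter s l).1.col ∧ (clutter s l).1.row < (clutter s l).2.row ∧
      (meetJoin s l).1.col = (clutter s l).2.col ∧ (meetJoin s l).1.row = (clutter s l).1.row ∧
      (meetJoin s l).2.col = (clutter s l).1.col ∧
      (meetJoin s l).2.row = (clutter s l).2.row) := by
  cases s <;> simp only [clutter, meetJoin] <;> split_ifs <;>
  simp only [AffineWeight.col, AffineWeight.row, SpinorWeight.col, SpinorWeight.row,
    true_and, and_true] <;> omega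

theorem not_le_clutter (s : VectorWeight) (l : ℤ) : ¬ (clutter s l).1 ≤ (clutter s l).2 := by
  have := clutter_rectangle s l
  rw [AffineWeight.le_iff]; omega

theorem not_ge_clutter (s : VectorWeight) (l : ℤ) : ¬ (clutter s l).2 ≤ (clutter s l).1 := by
  have := clutter_rectangle s l
  rw [AffineWeight.le_iff]; omega

theorem isGLB_clutter (s : VectorWeight) (l : ℤ) :
    IsGLB {(clutter s l).1, (clutter s l).2} (meetJoin s l).1 := by
  have := clutter_rectangle s l
  refine ⟨?_, fun x hx => ?_⟩
  · rintro x (rfl | rfl) <;> rw [AffineWeight.le_iff] <;> omega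
  · have h₁ := AffineWeight.le_iff.1 (hx (Set.mem_insert _ _))
    have h₂ := AffineWeight.le_iff.1 (hx (Set.mem_insert_of_mem _ (Set.mem_singleton _)))
    rw [AffineWeight.le_iff]; omega

theorem isLUB_clutter (s : VectorWeight) (l : ℤ) :
    IsLUB {(clutter s l).1, (clutter s l).2} (meetJoin s l).2 := by
  have := clutter_rectangle s l
  refine ⟨?_, fun x hx => ?_⟩
  · rintro x (rfl | rfl) <;> rw [AffineWeight.le_iff] <;> omega
  · have h₁ := AffineWeight.le_iff.1 (hx (Set.mem_insert _ _))
    have h₂ := AffineWeight.le_iff.1 (hx (Set.mem_insert_of_mem _ (Set.mem_singleton _)))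
    rw [AffineWeight.le_iff]; omega

/-- Each affinized quadric is homogeneous for both planar coordinates. Hence one factor of a
monomial determines the position of the other. -/
theorem col_add_col_of_mem_pairs {s : VectorWeight} {a b : AffineWeight}
    (h : (a.weight, b.weight) ∈ s.pairs) :
    a.col + b.col = (clutter s (a.level + b.level)).1.col +
        (clutter s (a.level + b.level)).2.col ∧
      a.row + b.row = (clutter s (a.level + b.level)).1.row +
        (clutter s (a.level + b.level)).2.row := by
  rcases a with ⟨α, i⟩
  rcases b with ⟨β, j⟩
  cases s <;>
  simp only [pairs, Finset.mem_insert, Finset.mem_singleton, Prod.mk.injEq] at h <;>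
  rcases h with ⟨rfl, rfl⟩ | ⟨rfl, rfl⟩ | ⟨rfl, rfl⟩ | ⟨rfl, rfl⟩ <;>
  simp only [clutter] <;> split_ifs <;>
  simp only [AffineWeight.col, AffineWeight.row, SpinorWeight.col, SpinorWeight.row] <;> omega

/-- It is enough to locate one factor: the coordinate sums are fixed, so a factor below the meet
forces the other one above the join. -/
theorem eq_clutter_or_le {s : VectorWeight} {a b : AffineWeight}
    (h : (a.weight, b.weight) ∈ s.pairs) {l : ℤ} (hl : a.level + b.level = l) :
    a = (clutter s l).1 ∨
      (a.col ≤ (meetJoin s l).1.col ∧ a.row ≤ (meetJoin s l).1.row) ∨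
      (b.col ≤ (meetJoin s l).1.col ∧ b.row ≤ (meetJoin s l).1.row) := by
  rcases a with ⟨α, i⟩
  rcases b with ⟨β, j⟩
  cases s <;>
  simp only [pairs, Finset.mem_insert, Finset.mem_singleton, Prod.mk.injEq] at h <;>
  rcases h with ⟨rfl, rfl⟩ | ⟨rfl, rfl⟩ | ⟨rfl, rfl⟩ | ⟨rfl, rfl⟩ <;>
  simp only [clutter, meetJoin] <;> split_ifs <;>
  simp only [AffineWeight.col, AffineWeight.row, SpinorWeight.col, SpinorWeight.row,
    AffineWeight.mk.injEq, reduceCtorEq, true_and, false_and, false_or] <;>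
  dsimp only at hl <;> omega

/-- The monomials of `Γ^{sˡ}` other than the clutter and its meet and join straddle the meet and
the join. -/
theorem eq_clutter_or {s : VectorWeight} {a b : AffineWeight}
    (h : (a.weight, b.weight) ∈ s.pairs) {l : ℤ} (hl : a.level + b.level = l) :
    (a, b) = clutter s l ∨ (a, b) = meetJoin s l ∨ (b, a) = meetJoin s l ∨
      (a < (meetJoin s l).1 ∧ (meetJoin s l).2 < b) ∨
      (b < (meetJoin s l).1 ∧ (meetJoin s l).2 < a) := by
  have h₁ := eq_clutter_or_le h hl
  have h₂ := col_add_col_of_mem_pairs h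
  have h₃ := clutter_rectangle s l
  rw [hl] at h₂
  simp only [Prod.ext_iff, AffineWeight.eq_iff, AffineWeight.lt_iff] at *
  rcases h₁ with h₁ | h₁ | h₁
  · left; omega
  · right
    by_cases h₄ : a.col = (meetJoin s l).1.col ∧ a.row = (meetJoin s l).1.row
    · left; omega
    · right; right; left; omega
  · right; right
    by_cases h₄ : b.col = (meetJoin s l).1.col ∧ b.row = (meetJoin s l).1.row
    · left; omega
    · right; right; omega

/-- The strip is so narrow that elements two or more levels apart are comparable. Only the level
differences -1, 0, 1 remain, which is a finite check on pairs of spinor weights. -/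
theorem exists_mem_pairs {a b : AffineWeight} (h₁ : ¬ a ≤ b) (h₂ : ¬ b ≤ a) :
    ∃ s : VectorWeight, (a.weight, b.weight) ∈ s.pairs ∨ (b.weight, a.weight) ∈ s.pairs := by
  by_contra hc
  rw [AffineWeight.le_iff] at h₁ h₂
  rcases a with ⟨α, i⟩
  rcases b with ⟨β, j⟩
  have key : ∀ α β : SpinorWeight,
      (¬ ∃ s : VectorWeight, (α, β) ∈ s.pairs ∨ (β, α) ∈ s.pairs) →
      ∀ k ∈ Finset.Icc (-1 : ℤ) 1, (4 * k + α.col ≤ β.col ∧ 4 * k + α.row ≤ β.row) ∨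
        (β.col ≤ 4 * k + α.col ∧ β.row ≤ 4 * k + α.row) := by
    decide +kernel
  have bd : ∀ α : SpinorWeight, 0 ≤ α.col ∧ α.col ≤ 3 ∧ α.col - 2 ≤ α.row ∧
    α.row ≤ α.col + 2 := by decide
  have hk := key α β hc (i - j)
  have hα := bd α
  have hβ := bd β
  simp only [Finset.mem_Icc] at hk
  simp only [AffineWeight.col, AffineWeight.row] at h₁ h₂
  omega

theorem exists_clutter {a b : AffineWeight} (h₁ : ¬ a ≤ b) (h₂ : ¬ b ≤ a) :
    ∃ (s : VectorWeight) (l : ℤ), (a, b) = clutter s l ∨ (b, a) = clutter s l := by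
  obtain ⟨s, h⟩ := exists_mem_pairs h₁ h₂
  have key : ∀ {a b : AffineWeight}, ¬ a ≤ b → ¬ b ≤ a → (a.weight, b.weight) ∈ s.pairs →
      (a, b) = clutter s (a.level + b.level) := by
    intro a b h₁ h₂ h
    have hr := clutter_rectangle s (a.level + b.level)
    have hc := eq_clutter_or h rfl
    simp only [Prod.ext_iff, AffineWeight.eq_iff, AffineWeight.lt_iff, AffineWeight.le_iff] at *
    omega
  rcases h with h | h
  · exact ⟨s, _, Or.inl (key h₁ h₂ h)⟩
  · exact ⟨s, _, Or.inr (key h₂ h₁ h)⟩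

/-- The quadrics have degree two, so raising all generators by `r` levels raises the power of `z` by
`2 * r`. Up to translation only `l = 0` and `l = 1` matter. -/
theorem clutter_shift (s : VectorWeight) (r l : ℤ) :
    clutter s (2 * r + l) = ((clutter s l).1.shift r, (clutter s l).2.shift r) := by
  have h₁ : (2 * r + l) % 2 = l % 2 := by omega
  have h₂ : (2 * r + l) / 2 = l / 2 + r := by omega
  cases s <;> simp only [clutter, h₁, h₂] <;> split_ifs <;>
    simp only [AffineWeight.shift, Prod.mk.injEq, AffineWeight.mk.injEq, true_and, and_true] <;>
    omega

/-- Each unordered pair is listed in one order only, so a reoriented monomial can be traced back to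
its original form. -/
theorem swap_notMem_pairs : ∀ (s : VectorWeight) (p : SpinorWeight × SpinorWeight),
    p ∈ s.pairs → p.swap ∉ s.pairs := by
  decide +kernel

end VectorWeight

/-! ### Linear syzygies of the quadrics -/

namespace VectorWeight

open SpinorWeight

/-- The linear syzygies `∑ ε λ^α Γ^s = 0` of the quadrics, as lists of triples `(ε, α, s)`. -/
def syzygies : List (List (ℤˣ × SpinorWeight × VectorWeight)) :=
  [[(1, w13, v1), (1, w23, v2), (-1, w35, v5), (-1, w34, v4), (1, o, u3)],
   [(1, w13, v3), (1, w12, v2), (1, w14, v4), (1, w15, v5), (-1, o, u1)],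
   [(1, w13, u2), (-1, p5, v4), (-1, p4, v5), (-1, w23, u1), (-1, w12, u3)],
   [(1, w13, u4), (1, p5, v2), (1, w34, u1), (1, p2, v5), (-1, w14, u3)],
   [(1, w13, u5), (1, p4, v2), (1, w35, u1), (-1, p2, v4), (-1, w15, u3)],
   [(1, w14, v1), (-1, w45, v5), (1, w24, v2), (1, w34, v3), (1, o, u4)],
   [(1, w14, u2), (1, p5, v3), (-1, w24, u1), (-1, p3, v5), (-1, w12, u4)],
   [(1, w14, u5), (1, w45, u1), (1, p3, v2), (1, p2, v3), (-1, w15, u4)],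
   [(1, w23, v3), (-1, w12, v1), (1, w25, v5), (1, w24, v4), (-1, o, u2)],
   [(1, w23, u4), (-1, p5, v1), (1, w34, u2), (-1, w24, u3), (1, p1, v5)],
   [(1, w23, u5), (-1, p4, v1), (1, w35, u2), (-1, w25, u3), (-1, p1, v4)],
   [(1, w15, v1), (1, w45, v4), (1, w35, v3), (1, w25, v2), (1, o, u5)],
   [(1, w15, u2), (-1, w25, u1), (1, p4, v3), (1, p3, v4), (-1, w12, u5)],
   [(1, w24, u5), (1, w45, u2), (-1, p3, v1), (-1, w25, u4), (1, p1, v3)],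
   [(1, w34, u5), (1, w45, u3), (-1, w35, u4), (-1, p2, v1), (-1, p1, v2)],
   [(1, p5, u5), (-1, p4, u4), (1, p3, u3), (-1, p2, u2), (1, p1, u1)]]

theorem sum_syzygy {R : Type*} [CommRing R] (x : SpinorWeight → R) :
    ∀ z ∈ syzygies, (z.map fun t => t.1 • (x t.2.1 * gammaQuadric t.2.2 x)).sum = 0 := by
  simp only [syzygies, List.forall_mem_cons, List.map_cons, List.map_nil, List.sum_cons,
    List.sum_nil, gammaQuadric, one_smul, Units.neg_smul, List.not_mem_nil, false_implies,
    implies_true, and_true]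
  refine ⟨?_, ?_, ?_, ?_, ?_, ?_, ?_, ?_, ?_, ?_, ?_, ?_, ?_, ?_, ?_, ?_⟩ <;> ring

/-- The sum of the squares of the heights in the leading monomial of `λ^g Γ^{sˡ}`. -/
def energy (g : AffineWeight) (s : VectorWeight) (l : ℤ) : ℤ :=
  g.ht ^ 2 + (clutter s l).1.ht ^ 2 + (clutter s l).2.ht ^ 2

/-- The sum of the heights in the leading monomial of `λ^g Γ^{sˡ}`. -/
def totalHt (g : AffineWeight) (s : VectorWeight) (l : ℤ) : ℤ :=
  g.ht + (clutter s l).1.ht + (clutter s l).2.ht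

/-- All three heights move by `8 * r`. The correction depends only on the total height, so
comparisons of energy between terms of equal total height are translation invariant. -/
theorem energy_shift (r : ℤ) (g : AffineWeight) (s : VectorWeight) (l : ℤ) :
    energy (g.shift r) s (2 * r + l) = energy g s l + 16 * r * totalHt g s l + 192 * r ^ 2 := by
  simp only [energy, totalHt, clutter_shift, AffineWeight.ht_shift]; ring

theorem totalHt_shift (r : ℤ) (g : AffineWeight) (s : VectorWeight) (l : ℤ) :
    totalHt (g.shift r) s (2 * r + l) = totalHt g s l + 24 * r := by
  simp only [totalHt, clutter_shift, AffineWeight.ht_shift]; ring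

/-- The two orderings of a pair. -/
def orderings (p : AffineWeight × AffineWeight) : List (AffineWeight × AffineWeight) :=
  [p, p.swap]

instance : DecidableEq AffineWeight := fun a b =>
  decidable_of_iff (a.weight = b.weight ∧ a.level = b.level) AffineWeight.ext_iff.symm

/-- The sign of the clutter monomial in `Γ^{sˡ}`. -/
def relSign (s : VectorWeight) (l : ℤ) : ℤˣ := s.sign (clutter s l).1.weight

/-- The total height of the monomials of `Γ^{s⁰}`. -/
def ht (s : VectorWeight) : ℤ := (clutter s 0).1.ht + (clutter s 0).2.ht

theorem ht_clutter (s : VectorWeight) (l : ℤ) :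
    (clutter s l).1.ht + (clutter s l).2.ht = s.ht + 8 * l := by
  have h := clutter_shift s (l / 2) (l % 2)
  rw [Int.mul_ediv_add_emod] at h
  rw [h]
  simp only [AffineWeight.ht_shift]
  rcases Int.emod_two_eq l with h | h <;> rw [h]
  · rw [ht]; omega
  · have : ∀ s, (clutter s 1).1.ht + (clutter s 1).2.ht = s.ht + 8 := by decide
    have := this s
    omega

/-- In some linear syzygy the two terms `λ^g Γ^{sˡ}` and `λ^{g'} Γ^{s'^{l'}}` have opposite leading
coefficients, and all other terms whose generator lies on levels `-4` to `5` have greater energy. -/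
def Resolves (g g' : AffineWeight) (s s' : VectorWeight) (l : ℤ) (m m' : ℤˣ) : Prop :=
  ∃ z ∈ syzygies, ∃ t ∈ z, ∃ t' ∈ z, t.2 = (g.weight, s) ∧ t'.2 = (g'.weight, s') ∧
    t.1 * m = - (t'.1 * m') ∧
    ∀ t'' ∈ z, t''.2.1.ht + t''.2.2.ht = g.weight.ht + s.ht ∧
      ∀ i ∈ [-4, -3, -2, -1, 0, 1, 2, 3, 4, 5], (t'' = t ∧ i = g.level) ∨
        (t'' = t' ∧ i = g'.level) ∨
        energy g s l < energy ⟨t''.2.1, i⟩ t''.2.2 (g.level + l - i)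

instance (g g' : AffineWeight) (s s' : VectorWeight) (l : ℤ) (m m' : ℤˣ) :
    Decidable (Resolves g g' s s' l m m') :=
  inferInstanceAs (Decidable (∃ z ∈ syzygies, ∃ t ∈ z, ∃ t' ∈ z, _))

/-- The finite core of the Gröbner property. For `l` equal to 0 or 1 the common element lies on
level 0 or 1, so the listed `l'` cover all cases. The bound 600 lies below 30², which later disposes
of generators on distant levels. -/
theorem overlap_base : ∀ s s' : VectorWeight, ∀ l ∈ [(0 : ℤ), 1],
    ∀ l' ∈ [(-2 : ℤ), -1, 0, 1, 2, 3, 4],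
    ∀ u ∈ orderings (clutter s l), ∀ v ∈ orderings (clutter s' l'), u.1 = v.1 → u.2 ≠ v.2 →
      energy v.2 s l ≤ 600 ∧ v.2.level + l = u.2.level + l' ∧
      Resolves v.2 u.2 s s' l (relSign s l) (relSign s' l') := by
  decide +kernel

theorem mem_orderings {p q : AffineWeight × AffineWeight} :
    q ∈ orderings p ↔ q = p ∨ q = p.swap := by
  simp [orderings]

theorem exists_shift_of_mem_orderings {s : VectorWeight} {r l : ℤ}
    {u : AffineWeight × AffineWeight} (hu : u ∈ orderings (clutter s (2 * r + l))) :
    ∃ u₀ ∈ orderings (clutter s l), u = (u₀.1.shift r, u₀.2.shift r) := by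
  rw [mem_orderings, clutter_shift] at hu
  rcases hu with rfl | rfl
  · exact ⟨_, mem_orderings.2 (Or.inl rfl), rfl⟩
  · exact ⟨_, mem_orderings.2 (Or.inr rfl), rfl⟩

theorem level_of_mem_orderings {s : VectorWeight} {l : ℤ}
    {u : AffineWeight × AffineWeight} (hu : u ∈ orderings (clutter s l)) :
    l / 2 ≤ u.1.level ∧ u.1.level ≤ l / 2 + 1 := by
  have h : (l / 2 ≤ (clutter s l).1.level ∧ (clutter s l).1.level ≤ l / 2 + 1) ∧
      (l / 2 ≤ (clutter s l).2.level ∧ (clutter s l).2.level ≤ l / 2 + 1) := by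
    cases s <;> simp only [clutter] <;> split_ifs <;> dsimp only <;> omega
  rcases mem_orderings.1 hu with rfl | rfl
  · exact h.1
  · exact h.2

theorem shift_injective (r : ℤ) : Function.Injective (AffineWeight.shift r) := by
  intro a b h
  simp only [AffineWeight.shift, AffineWeight.mk.injEq] at h
  exact AffineWeight.ext h.1 (by omega)

theorem relSign_shift (s : VectorWeight) (r l : ℤ) : relSign s (2 * r + l) = relSign s l := by
  simp only [relSign, clutter_shift, AffineWeight.shift]

theorem totalHt_eq (g : AffineWeight) (s : VectorWeight) (l : ℤ) :
    totalHt g s l = g.weight.ht + s.ht + 8 * (g.level + l) := by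
  have := ht_clutter s l
  simp only [totalHt, AffineWeight.ht]
  simp only [AffineWeight.ht] at this
  omega

/-- Two clutters with a common element are the leading terms of a linear syzygy in which all other
terms have greater energy. -/
theorem exists_syzygy {s s' : VectorWeight} {l l' : ℤ} {u v : AffineWeight × AffineWeight}
    (hu : u ∈ orderings (clutter s l)) (hv : v ∈ orderings (clutter s' l')) (huv : u.1 = v.1)
    (hne : u.2 ≠ v.2) :
    v.2.level + l = u.2.level + l' ∧
    ∃ z ∈ syzygies, ∃ t ∈ z, ∃ t' ∈ z, t.2 = (v.2.weight, s) ∧ t'.2 = (u.2.weight, s') ∧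
      t.1 * relSign s l = - (t'.1 * relSign s' l') ∧
      ∀ t'' ∈ z, ∀ i : ℤ, (t'' = t ∧ i = v.2.level) ∨ (t'' = t' ∧ i = u.2.level) ∨
        (totalHt ⟨t''.2.1, i⟩ t''.2.2 (v.2.level + l - i) = totalHt v.2 s l ∧
          energy v.2 s l < energy ⟨t''.2.1, i⟩ t''.2.2 (v.2.level + l - i)) := by
  have hl := level_of_mem_orderings hu
  have hl' := level_of_mem_orderings hv
  rw [← huv] at hl'
  -- Translate by `r = l / 2` levels to reach the range of `overlap_base`; the levels of the common
  -- element then confine `l'`.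
  obtain ⟨r, l, rfl, h₀⟩ : ∃ r l₀, l = 2 * r + l₀ ∧ (l₀ = 0 ∨ l₀ = 1) :=
    ⟨l / 2, l % 2, by omega, by omega⟩
  obtain ⟨l', rfl⟩ : ∃ k, l' = 2 * r + k := ⟨l' - 2 * r, by omega⟩
  obtain ⟨u, hu₀, rfl⟩ := exists_shift_of_mem_orderings hu
  obtain ⟨v, hv₀, rfl⟩ := exists_shift_of_mem_orderings hv
  dsimp only at *
  obtain ⟨hE, hL, z, hz, t, ht, t', ht', h₁, h₂, h₃, h₄⟩ := overlap_base s s' l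
    (by simpa using h₀) l' (by simp; omega) u hu₀ v hv₀ (shift_injective r huv)
    (fun h => hne (congrArg _ h))
  refine ⟨by simp only [AffineWeight.shift]; omega, z, hz, t, ht, t', ht', h₁, h₂,
    by simpa only [relSign_shift] using h₃, fun t'' ht'' i => ?_⟩
  obtain ⟨i, rfl⟩ : ∃ k, i = k + r := ⟨i - r, by omega⟩
  obtain ⟨h₅, h₆⟩ := h₄ t'' ht''
  have hg : (⟨t''.2.1, i + r⟩ : AffineWeight) = AffineWeight.shift r ⟨t''.2.1, i⟩ := rfl
  have hlev : (AffineWeight.shift r v.2).level + (2 * r + l) - (i + r) =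
      2 * r + (v.2.level + l - i) := by
    simp only [AffineWeight.shift]; ring
  rw [hlev, hg, energy_shift, energy_shift, totalHt_shift, totalHt_shift]
  have h₇ : totalHt ⟨t''.2.1, i⟩ t''.2.2 (v.2.level + l - i) = totalHt v.2 s l := by
    rw [totalHt_eq, totalHt_eq]; dsimp only; omega
  rw [h₇]
  by_cases hi : i ∈ [(-4 : ℤ), -3, -2, -1, 0, 1, 2, 3, 4, 5]
  · rcases h₆ i hi with h | h | h
    · exact Or.inl ⟨h.1, by simp only [AffineWeight.shift]; omega⟩
    · exact Or.inr (Or.inl ⟨h.1, by simp only [AffineWeight.shift]; omega⟩)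
    · exact Or.inr (Or.inr ⟨rfl, by linarith⟩)
  -- On levels below -4 or above 5 the generator has height at most -30 or at least 48. Its square
  -- alone exceeds 600, the bound on the energy of the leading terms.
  · refine Or.inr (Or.inr ⟨rfl, ?_⟩)
    have hb := SpinorWeight.ht_bounds t''.2.1
    have h₈ : 600 < (AffineWeight.mk t''.2.1 i).ht ^ 2 := by
      simp only [AffineWeight.ht]
      have : 8 * i + t''.2.1.ht ≤ -30 ∨ 48 ≤ 8 * i + t''.2.1.ht := by
        simp at hi; omega
      rcases this with h | h <;> nlinarith
    have h₉ : (AffineWeight.mk t''.2.1 i).ht ^ 2 ≤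
        energy ⟨t''.2.1, i⟩ t''.2.2 (v.2.level + l - i) := by
      rw [energy]; nlinarith [sq_nonneg (clutter t''.2.2 (v.2.level + l - i)).1.ht,
        sq_nonneg (clutter t''.2.2 (v.2.level + l - i)).2.ht]
    linarith

theorem eq_of_mem_pairs : ∀ (s s' : VectorWeight) (p : SpinorWeight × SpinorWeight),
    p ∈ s.pairs → p ∈ s'.pairs ∨ p.swap ∈ s'.pairs → s = s' := by
  decide +kernel

/-- A clutter determines its quadric. -/
theorem eq_of_mem_orderings {s s' : VectorWeight} {l l' : ℤ} {u : AffineWeight × AffineWeight}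
    (hu : u ∈ orderings (clutter s l)) (hv : u ∈ orderings (clutter s' l')) :
    s = s' ∧ l = l' := by
  have h₁ := mem_pairs_clutter s l
  have h₂ := mem_pairs_clutter s' l'
  have h₃ := level_clutter s l
  have h₄ := level_clutter s' l'
  rw [mem_orderings] at hu hv
  have : clutter s' l' = clutter s l ∨ clutter s' l' = (clutter s l).swap := by
    rcases hu with rfl | rfl <;> rcases hv with h | h
    · exact Or.inl h.symm
    · exact Or.inr (by rw [h, Prod.swap_swap])
    · exact Or.inr h.symm
    · exact Or.inl (Prod.swap_injective h.symm)
  rcases this with h | h <;> rw [h] at h₂ h₄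
  · exact ⟨eq_of_mem_pairs _ _ _ h₁ (Or.inl h₂), by omega⟩
  · exact ⟨eq_of_mem_pairs _ _ _ h₁ (Or.inr h₂),
      by simp only [Prod.fst_swap, Prod.snd_swap] at h₄; omega⟩

/-- With the sum of two numbers fixed, the sum of their squares grows with their distance. A
monomial other than the clutter has a factor at or below the meet, hence of height less than both
clutter elements, so its heights are further apart. -/
theorem ht_le_of_mem_pairs {s : VectorWeight} {a b : AffineWeight}
    (h : (a.weight, b.weight) ∈ s.pairs) {l : ℤ} (hl : a.level + b.level = l) :
    a.ht + b.ht = (clutter s l).1.ht + (clutter s l).2.ht ∧ ((a, b) = clutter s l ∨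
      (clutter s l).1.ht ^ 2 + (clutter s l).2.ht ^ 2 < a.ht ^ 2 + b.ht ^ 2) := by
  have h₁ := eq_clutter_or h hl
  have h₂ := col_add_col_of_mem_pairs h
  have h₃ := clutter_rectangle s l
  rw [hl] at h₂
  have h₅ : a.ht + b.ht = (clutter s l).1.ht + (clutter s l).2.ht := by
    simp only [AffineWeight.ht_eq_col_add_row]; omega
  refine ⟨h₅, h₁.imp id fun h₁ => ?_⟩
  have h₄ : (a.ht < (clutter s l).1.ht ∧ a.ht < (clutter s l).2.ht) ∨
      (b.ht < (clutter s l).1.ht ∧ b.ht < (clutter s l).2.ht) := by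
    simp only [Prod.ext_iff, AffineWeight.eq_iff, AffineWeight.lt_iff,
      AffineWeight.ht_eq_col_add_row] at *
    omega
  generalize (clutter s l).1.ht = p at *
  generalize (clutter s l).2.ht = q at *
  obtain rfl : q = a.ht + b.ht - p := by omega
  rcases h₄ with h₄ | h₄ <;> nlinarith

end VectorWeight

/-! ### A Buchberger criterion for weighted rewriting -/

namespace MvPolynomial

section Buchberger

variable {σ ι k : Type*} [CommRing k] (w : σ → ℕ) (q : ι → MvPolynomial σ k) (e : ι → σ →₀ ℕ)

/-- The polynomials all of whose monomials have weight less than `W`. -/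
noncomputable def weightLT (k : Type*) [CommRing k] (W : ℕ) : Submodule k (MvPolynomial σ k) :=
  restrictSupport k {m | Finsupp.weight w m < W}

/-- The span of the multiples of the relations `q t` whose leading monomial has weight less than
`W`, where `e t` is the leading exponent of `q t`. -/
noncomputable def lowerSpan (W : ℕ) : Submodule k (MvPolynomial σ k) :=
  Submodule.span k {p | ∃ n t, Finsupp.weight w (n + e t) < W ∧ p = monomial n 1 * q t}

variable {w q e}

theorem monomial_mem_weightLT {m : σ →₀ ℕ} {W : ℕ} (h : Finsupp.weight w m < W) (c : k) :
    monomial m c ∈ weightLT w k W := by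
  rw [weightLT, mem_restrictSupport_iff]
  intro x hx
  have := support_monomial_subset hx
  rw [Finset.mem_singleton] at this
  rwa [this]

theorem weightLT_mono {V W : ℕ} (h : V ≤ W) : weightLT w k V ≤ weightLT w k W :=
  restrictSupport_mono k fun _ hm => lt_of_lt_of_le hm h

theorem lowerSpan_mono {V W : ℕ} (h : V ≤ W) : lowerSpan w q e V ≤ lowerSpan w q e W :=
  Submodule.span_mono fun _ ⟨n, t, h₁, h₂⟩ => ⟨n, t, lt_of_lt_of_le h₁ h, h₂⟩

theorem mem_of_forall_monomial {p : MvPolynomial σ k} {W : ℕ} (hp : p ∈ weightLT w k W)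
    {N : Submodule k (MvPolynomial σ k)} (f : MvPolynomial σ k →ₗ[k] MvPolynomial σ k)
    (h : ∀ m, Finsupp.weight w m < W → f (monomial m 1) ∈ N) : f p ∈ N := by
  rw [weightLT, mem_restrictSupport_iff] at hp
  rw [p.as_sum, map_sum]
  refine N.sum_mem fun m hm => ?_
  have : monomial m (p.coeff m) = p.coeff m • monomial m (1 : k) := by
    rw [smul_monomial, smul_eq_mul, mul_one]
  rw [this, map_smul]
  exact N.smul_mem _ (h m (hp hm))

theorem monomial_mul_mem_weightLT {p : MvPolynomial σ k} {W : ℕ} (hp : p ∈ weightLT w k W)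
    (n : σ →₀ ℕ) : monomial n 1 * p ∈ weightLT w k (Finsupp.weight w n + W) := by
  refine mem_of_forall_monomial hp (LinearMap.mulLeft k (monomial n 1)) fun m hm => ?_
  rw [LinearMap.mulLeft_apply, monomial_mul]
  exact monomial_mem_weightLT (by rw [map_add]; omega) _

theorem mul_mem_lowerSpan {p : MvPolynomial σ k} {W : ℕ} (hp : p ∈ weightLT w k W)
    (t : ι) : p * q t ∈ lowerSpan w q e (W + Finsupp.weight w (e t)) := by
  refine mem_of_forall_monomial hp (LinearMap.mulRight k (q t)) fun m hm => ?_
  exact Submodule.subset_span ⟨m, t, by rw [map_add]; omega, rfl⟩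

theorem monomial_mul_mem_lowerSpan {x : MvPolynomial σ k} {W : ℕ}
    (hx : x ∈ lowerSpan w q e W) (n : σ →₀ ℕ) :
    monomial n 1 * x ∈ lowerSpan w q e (Finsupp.weight w n + W) := by
  have : lowerSpan w q e W ≤ (lowerSpan w q e (Finsupp.weight w n + W)).comap
      (LinearMap.mulLeft k (monomial n 1)) := by
    refine Submodule.span_le.2 ?_
    rintro _ ⟨m, t, h, rfl⟩
    refine Submodule.subset_span ⟨n + m, t, by rw [add_assoc, map_add]; omega, ?_⟩
    rw [LinearMap.mulLeft_apply, ← mul_assoc, monomial_mul, one_mul]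
  exact this hx

/-- Supplies the starting weight for the descent in `eq_zero_of_mem_span_range`. -/
theorem exists_mem_lowerSpan {x : MvPolynomial σ k} (hx : x ∈ Ideal.span (Set.range q)) :
    ∃ W, x ∈ lowerSpan w q e W := by
  induction hx using Submodule.span_induction with
  | mem x h =>
    obtain ⟨t, rfl⟩ := h
    exact ⟨_, Submodule.subset_span ⟨0, t, Nat.lt_succ_self _, by rw [← C_apply, C_1, one_mul]⟩⟩
  | zero => exact ⟨0, Submodule.zero_mem _⟩
  | add x y _ _ hx hy =>
    obtain ⟨V, hV⟩ := hx
    obtain ⟨W, hW⟩ := hy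
    exact ⟨max V W, Submodule.add_mem _ (lowerSpan_mono (le_max_left _ _) hV)
      (lowerSpan_mono (le_max_right _ _) hW)⟩
  | smul p x _ hx =>
    obtain ⟨V, hV⟩ := hx
    rw [smul_eq_mul]
    induction p using MvPolynomial.induction_on' with
    | monomial n c =>
      refine ⟨Finsupp.weight w n + V, ?_⟩
      have : monomial n c * x = c • (monomial n 1 * x) := by
        rw [← smul_mul_assoc, smul_monomial, smul_eq_mul, mul_one]
      rw [this]
      exact Submodule.smul_mem _ _ (monomial_mul_mem_lowerSpan hV n)
    | add p p' hp hp' =>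
      obtain ⟨A, hA⟩ := hp
      obtain ⟨B, hB⟩ := hp'
      rw [add_mul]
      exact ⟨max A B, Submodule.add_mem _ (lowerSpan_mono (le_max_left _ _) hA)
        (lowerSpan_mono (le_max_right _ _) hB)⟩

theorem monomial_mul_sub_mem_weightLT
    (hlead : ∀ t, q t - monomial (e t) 1 ∈ weightLT w k (Finsupp.weight w (e t)))
    (n : σ →₀ ℕ) (t : ι) :
    monomial n 1 * q t - monomial (n + e t) 1 ∈ weightLT w k (Finsupp.weight w (n + e t)) := by
  have := monomial_mul_mem_weightLT (hlead t) n
  rwa [mul_sub, monomial_mul, one_mul, ← map_add] at this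

theorem lowerSpan_le_weightLT
    (hlead : ∀ t, q t - monomial (e t) 1 ∈ weightLT w k (Finsupp.weight w (e t)))
    (W : ℕ) : lowerSpan w q e W ≤ weightLT w k W := by
  refine Submodule.span_le.2 ?_
  rintro _ ⟨n, t, h, rfl⟩
  have h₁ := weightLT_mono h.le (monomial_mul_sub_mem_weightLT hlead n t)
  have h₂ := Submodule.add_mem _ h₁ (monomial_mem_weightLT h (1 : k))
  rwa [sub_add_cancel] at h₂

/-- Relations with coprime leading monomials: the Koszul syzygy. -/
theorem koszul_mem_lowerSpan
    (hlead : ∀ t, q t - monomial (e t) 1 ∈ weightLT w k (Finsupp.weight w (e t)))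
    (t t' : ι) :
    monomial (e t') 1 * q t - monomial (e t) 1 * q t' ∈
      lowerSpan w q e (Finsupp.weight w (e t + e t')) := by
  have h₁ := mul_mem_lowerSpan (e := e) (hlead t) t' (q := q)
  have h₂ := mul_mem_lowerSpan (e := e) (hlead t') t (q := q)
  rw [← map_add] at h₁ h₂
  rw [add_comm] at h₂
  -- Both memberships concern a tail times the other relation; in their difference the products `q t
  -- * q t'` cancel.
  convert Submodule.sub_mem _ h₁ h₂ using 1
  ring

variable (q e) in
/-- The multiple of a relation `q t` with leading exponent `m`, if `m` is divisible by some leading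
exponent. -/
noncomputable def reducer (m : σ →₀ ℕ) : MvPolynomial σ k :=
  open Classical in
  if h : ∃ t, e t ≤ m then monomial (m - e h.choose) 1 * q h.choose else 0

theorem reducer_sub_mem_weightLT
    (hlead : ∀ t, q t - monomial (e t) 1 ∈ weightLT w k (Finsupp.weight w (e t)))
    {m : σ →₀ ℕ} (h : ∃ t, e t ≤ m) :
    reducer q e m - monomial m 1 ∈ weightLT w k (Finsupp.weight w m) := by
  have := monomial_mul_sub_mem_weightLT hlead (m - e h.choose) h.choose
  rw [reducer, dif_pos h]
  rwa [tsub_add_cancel_of_le h.choose_spec] at this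

/-- By `hover`, multiples of relations with the same leading exponent agree modulo lower weight. One
chosen `reducer` per exponent therefore represents the whole layer of weight `W`. -/
theorem exists_sub_mem_lowerSpan
    (hover : ∀ t t' n n', n + e t = n' + e t' →
      monomial n 1 * q t - monomial n' 1 * q t' ∈
        lowerSpan w q e (Finsupp.weight w (n + e t)))
    {W : ℕ} {x : MvPolynomial σ k} (hx : x ∈ lowerSpan w q e (W + 1)) :
    ∃ c : (σ →₀ ℕ) →₀ k, (∀ m ∈ c.support, Finsupp.weight w m = W ∧ ∃ t, e t ≤ m) ∧
      x - c.sum (fun m r => r • reducer q e m) ∈ lowerSpan w q e W := by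
  have hle : lowerSpan w q e (W + 1) ≤ lowerSpan w q e W ⊔ Submodule.span k
      (reducer q e '' {m | Finsupp.weight w m = W ∧ ∃ t, e t ≤ m}) := by
    refine Submodule.span_le.2 ?_
    rintro _ ⟨n, t, h, rfl⟩
    rcases (Nat.lt_succ_iff.1 h).lt_or_eq with h | h
    · exact Submodule.mem_sup_left (Submodule.subset_span ⟨n, t, h, rfl⟩)
    · have hex : ∃ t', e t' ≤ n + e t := ⟨t, le_add_self⟩
      refine Submodule.mem_sup.2 ⟨monomial n 1 * q t - reducer q e (n + e t), ?_,
        reducer q e (n + e t), Submodule.subset_span ⟨_, ⟨h, hex⟩, rfl⟩, sub_add_cancel _ _⟩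
      rw [← h, reducer, dif_pos hex]
      exact hover _ _ _ _ (tsub_add_cancel_of_le hex.choose_spec).symm
  obtain ⟨y, hy, z, hz, rfl⟩ := Submodule.mem_sup.1 (hle hx)
  obtain ⟨c, hc, rfl⟩ := (Finsupp.mem_span_image_iff_linearCombination k).1 hz
  refine ⟨c, fun m hm => hc hm, ?_⟩
  rwa [Finsupp.linearCombination_apply, add_sub_cancel_right]

/-- If all overlaps of leading monomials resolve, then no nonzero element of the ideal is a
combination of monomials that are not divisible by leading monomials. -/
theorem eq_zero_of_mem_span_range
    (hlead : ∀ t, q t - monomial (e t) 1 ∈ weightLT w k (Finsupp.weight w (e t)))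
    (hover : ∀ t t' n n', n + e t = n' + e t' →
      monomial n 1 * q t - monomial n' 1 * q t' ∈
        lowerSpan w q e (Finsupp.weight w (n + e t)))
    {x : MvPolynomial σ k} (hx : x ∈ Ideal.span (Set.range q))
    (hstd : ∀ m ∈ x.support, ∀ t, ¬ e t ≤ m) : x = 0 := by
  classical
  obtain ⟨W, hW⟩ := exists_mem_lowerSpan (w := w) (e := e) hx
  clear hx
  induction W with
  | zero =>
    have : lowerSpan w q e 0 = ⊥ := by
      refine (Submodule.span_eq_bot).2 ?_
      rintro _ ⟨n, t, h, -⟩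
      exact absurd h (Nat.not_lt_zero _)
    rwa [this] at hW
  | succ W ih =>
    refine ih ?_
    obtain ⟨c, h₁, h₂⟩ := exists_sub_mem_lowerSpan hover hW
    suffices hc : c = 0 by simpa [hc] using h₂
    by_contra hc
    -- Compare coefficients at `m`, of weight `W`. The remainder and the tails of all reducers have
    -- lower weight, so `x` has coefficient `c m ≠ 0` at an exponent divisible by a leading one,
    -- contrary to `hstd`.
    obtain ⟨m, hm⟩ := Finsupp.support_nonempty_iff.2 hc
    have hzero : ∀ y ∈ weightLT w k W, y.coeff m = 0 := by
      intro y hy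
      by_contra h
      have := hy (mem_support_iff.2 h)
      exact absurd (h₁ m hm).1 (ne_of_lt this)
    have h₃ := hzero _ (lowerSpan_le_weightLT hlead W h₂)
    have h₄ : (c.sum fun m r => r • reducer q e m).coeff m = c m := by
      rw [Finsupp.sum, coeff_sum, Finset.sum_eq_single m]
      · have := hzero _ ((h₁ m hm).1 ▸ reducer_sub_mem_weightLT hlead (h₁ m hm).2)
        rw [coeff_sub, coeff_monomial, if_pos rfl, sub_eq_zero] at this
        rw [coeff_smul, this, smul_eq_mul, mul_one]
      · intro m' hm' hne
        have := hzero _ ((h₁ m' hm').1 ▸ reducer_sub_mem_weightLT hlead (h₁ m' hm').2)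
        rw [coeff_sub, coeff_monomial, if_neg hne, sub_zero] at this
        rw [coeff_smul, this, smul_zero]
      · exact fun h => absurd hm h
    rw [coeff_sub, h₄, sub_eq_zero] at h₃
    obtain ⟨t, ht⟩ := (h₁ m hm).2
    exact hstd m (mem_support_iff.2 (h₃ ▸ Finsupp.mem_support_iff.1 hm)) t ht

/-- Every polynomial is congruent, modulo the ideal of the relations, to a combination of monomials
that are not divisible by leading monomials. -/
theorem mem_span_sup_span_range
    (hlead : ∀ t, q t - monomial (e t) 1 ∈ weightLT w k (Finsupp.weight w (e t)))
    (x : MvPolynomial σ k) :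
    x ∈ Submodule.span k ((fun m => monomial m (1 : k)) '' {m | ∀ t, ¬ e t ≤ m}) ⊔
      (Ideal.span (Set.range q)).restrictScalars k := by
  set N := Submodule.span k ((fun m => monomial m (1 : k)) '' {m | ∀ t, ¬ e t ≤ m}) ⊔
      (Ideal.span (Set.range q)).restrictScalars k with hN
  have key : ∀ W m, Finsupp.weight w m < W → monomial m (1 : k) ∈ N := by
    intro W
    induction W with
    | zero => exact fun m h => absurd h (Nat.not_lt_zero _)
    | succ W ih =>
      intro m hm
      by_cases h : ∃ t, e t ≤ m
      · obtain ⟨t, ht⟩ := h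
        obtain ⟨n, rfl⟩ := exists_add_of_le ht
        rw [add_comm] at hm ⊢
        have h₁ : monomial n 1 * q t ∈ N := Submodule.mem_sup_right
          (Ideal.mul_mem_left _ _ (Ideal.subset_span ⟨t, rfl⟩))
        have h₂ : monomial n 1 * q t - monomial (n + e t) 1 ∈ N :=
          mem_of_forall_monomial (weightLT_mono (Nat.lt_succ_iff.1 hm)
            (monomial_mul_sub_mem_weightLT hlead n t)) LinearMap.id ih
        simpa using N.sub_mem h₁ h₂
      · push Not at h
        exact Submodule.mem_sup_left (Submodule.subset_span ⟨m, h, rfl⟩)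
  rw [x.as_sum]
  refine N.sum_mem fun m _ => ?_
  have : monomial m (x.coeff m) = x.coeff m • monomial m (1 : k) := by
    rw [smul_monomial, smul_eq_mul, mul_one]
  rw [this]
  exact N.smul_mem _ (key _ m (Nat.lt_succ_self _))

end Buchberger

end MvPolynomial

/-! ### Standard monomials and exponents -/

section StandardMonomials

open MvPolynomial

variable {H : Type*} [PartialOrder H]

/-- The exponent of the monomial with the given list of factors. -/
noncomputable def listExponent {H : Type*} (l : List H) : H →₀ ℕ :=
  (l.map fun a => Finsupp.single a 1).sum

theorem prod_map_X {H k : Type*} [CommRing k] (l : List H) :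
    (l.map X).prod = monomial (listExponent l) (1 : k) := by
  induction l with
  | nil => rw [List.map_nil, List.prod_nil, listExponent, List.map_nil, List.sum_nil]; rfl
  | cons a l ih =>
    rw [List.map_cons, List.prod_cons, ih, X, monomial_mul, one_mul, listExponent, listExponent,
      List.map_cons, List.sum_cons]

theorem listExponent_eq_toFinsupp {H : Type*} [DecidableEq H] (l : List H) :
    listExponent l = Multiset.toFinsupp (l : Multiset H) := by
  induction l with
  | nil => rw [listExponent, List.map_nil, List.sum_nil, Multiset.coe_nil, map_zero]
  | cons a l ih =>
    rw [← Multiset.cons_coe, ← Multiset.singleton_add, map_add, Multiset.toFinsupp_singleton, ← ih,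
      listExponent, List.map_cons, List.sum_cons, listExponent]

theorem listExponent_injective :
    Function.Injective fun l : Multichain H => listExponent l.1 := by
  classical
  intro l l' h
  simp only [listExponent_eq_toFinsupp, EmbeddingLike.apply_eq_iff_eq, Multiset.coe_eq_coe] at h
  exact Subtype.ext (h.eq_of_pairwise (fun a b _ _ h h' => le_antisymm h h') l.2 l'.2)

theorem mem_of_le_listExponent {H : Type*} {l : List H} {a : H}
    (h : Finsupp.single a 1 ≤ listExponent l) : a ∈ l := by
  classical
  rw [listExponent_eq_toFinsupp, Finsupp.single_le_iff, Multiset.toFinsupp_apply,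
    Multiset.one_le_count_iff_mem, Multiset.mem_coe] at h
  exact h

/-- Sort the factors along a linear extension of the order; on pairwise comparable elements it
agrees with the original order. -/
theorem exists_multichain {m : H →₀ ℕ} (h : ∀ a ∈ m.support, ∀ b ∈ m.support, a ≤ b ∨ b ≤ a) :
    ∃ l : Multichain H, listExponent l.1 = m := by
  classical
  obtain ⟨l, hl, hs⟩ : ∃ l : List H, (l : Multiset H) = Finsupp.toMultiset m ∧
      l.Pairwise fun a b => toLinearExtension a ≤ toLinearExtension b := by
    let s : Multiset (LinearExtension H) := Finsupp.toMultiset m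
    exact ⟨(s.sort (· ≤ ·) : List (LinearExtension H)), Multiset.sort_eq s (· ≤ ·),
      Multiset.pairwise_sort s (· ≤ ·)⟩
  have hm : ∀ {c : H}, c ∈ l → c ∈ m.support := fun hc => by
    rwa [← Finsupp.mem_toMultiset, ← hl, Multiset.mem_coe]
  refine ⟨⟨l, hs.imp_of_mem fun {a b} ha hb hab => ?_⟩, ?_⟩
  · rcases h a (hm ha) b (hm hb) with h | h
    · exact h
    · have h' : toLinearExtension a = toLinearExtension b :=
        le_antisymm hab (toLinearExtension.monotone h)
      exact le_of_eq h'
  · rw [listExponent_eq_toFinsupp, hl, Finsupp.toMultiset_toFinsupp]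

theorem standardMonomial_eq_mk {k : Type*} [CommRing k] (I : Ideal (MvPolynomial H k))
    (l : Multichain H) :
    standardMonomial (fun a => Ideal.Quotient.mk I (X a)) l =
      Ideal.Quotient.mk I (monomial (listExponent l.1) 1) := by
  rw [← prod_map_X, map_list_prod, List.map_map]; rfl

variable {ι k : Type*} [CommRing k] {w : H → ℕ} {q : ι → MvPolynomial H k} {e : ι → H →₀ ℕ}

/-- Chain monomials are independent in the polynomial ring, and by `eq_zero_of_mem_span_range` their
span meets the ideal only in zero, so independence passes to the quotient. -/
theorem linearIndependent_standardMonomial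
    (hlead : ∀ t, q t - monomial (e t) 1 ∈ weightLT w k (Finsupp.weight w (e t)))
    (hover : ∀ t t' n n', n + e t = n' + e t' →
      monomial n 1 * q t - monomial n' 1 * q t' ∈
        lowerSpan w q e (Finsupp.weight w (n + e t)))
    (hchain : ∀ (l : Multichain H) (t : ι), ¬ e t ≤ listExponent l.1) :
    LinearIndependent k (standardMonomial (H := H)
      fun a => Ideal.Quotient.mk (Ideal.span (Set.range q)) (X a)) := by
  have h₁ := (basisMonomials H k).linearIndependent.comp _ listExponent_injective
  have h₂ := h₁.map (f := (Ideal.Quotient.mkₐ k (Ideal.span (Set.range q))).toLinearMap) ?_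
  · have h₃ : (standardMonomial fun a => Ideal.Quotient.mk (Ideal.span (Set.range q)) (X a)) =
        (Ideal.Quotient.mkₐ k (Ideal.span (Set.range q))).toLinearMap ∘
          (basisMonomials H k) ∘ fun l : Multichain H => listExponent l.1 := by
      funext l
      rw [standardMonomial_eq_mk, Function.comp_apply, Function.comp_apply, coe_basisMonomials]
      rfl
    rw [h₃]
    exact h₂
  · rw [Submodule.disjoint_def]
    intro x hx hx'
    have hx' : x ∈ Ideal.span (Set.range q) := Ideal.Quotient.eq_zero_iff_mem.1 hx'
    refine eq_zero_of_mem_span_range hlead hover hx' ?_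
    have hle : Submodule.span k (Set.range (basisMonomials H k ∘
        fun l : Multichain H => listExponent l.1)) ≤
        restrictSupport k (Set.range fun l : Multichain H => listExponent l.1) := by
      refine Submodule.span_le.2 ?_
      rintro _ ⟨l, rfl⟩
      rw [Function.comp_apply, coe_basisMonomials]
      exact (monomial_mem_restrictSupport k).2 (Or.inl ⟨l, rfl⟩)
    intro m hm t
    obtain ⟨l, rfl⟩ := hle hx hm
    exact hchain l t

theorem span_standardMonomial_eq_top
    (hlead : ∀ t, q t - monomial (e t) 1 ∈ weightLT w k (Finsupp.weight w (e t)))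
    (hcover : ∀ m : H →₀ ℕ, (∀ t, ¬ e t ≤ m) → ∃ l : Multichain H, listExponent l.1 = m) :
    Submodule.span k (Set.range (standardMonomial (H := H)
      fun a => Ideal.Quotient.mk (Ideal.span (Set.range q)) (X a))) = ⊤ := by
  refine eq_top_iff.2 fun y _ => ?_
  obtain ⟨x, rfl⟩ := Ideal.Quotient.mk_surjective y
  obtain ⟨u, hu, v, hv, rfl⟩ := Submodule.mem_sup.1 (mem_span_sup_span_range hlead x)
  rw [map_add, Ideal.Quotient.eq_zero_iff_mem.2 hv, add_zero]
  have hle : Submodule.span k ((fun m => monomial m (1 : k)) '' {m | ∀ t, ¬ e t ≤ m}) ≤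
      (Submodule.span k (Set.range (standardMonomial (H := H)
        fun a => Ideal.Quotient.mk (Ideal.span (Set.range q)) (X a)))).comap
        (Ideal.Quotient.mkₐ k (Ideal.span (Set.range q))).toLinearMap := by
    refine Submodule.span_le.2 ?_
    rintro _ ⟨m, hm, rfl⟩
    obtain ⟨l, rfl⟩ := hcover m hm
    exact Submodule.subset_span ⟨l, standardMonomial_eq_mk _ l⟩
  exact hle hu

end StandardMonomials

/-! ### The affinized quadrics -/

section AffineQuadrics

open VectorWeight

theorem gammaQuadric_eq_sum {R : Type*} [CommRing R] (s : VectorWeight) (x : SpinorWeight → R) :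
    gammaQuadric s x = ∑ p ∈ s.pairs, s.sign p.1 • (x p.1 * x p.2) := by
  cases s <;> simp [gammaQuadric, pairs, sign, Finset.sum_insert] <;> ring

variable {d d' : AffineWeight}

theorem coeff_spinorSeries_mul (α : SpinorWeight) (f : LaurentPolynomial (IntervalPoly d d'))
    (l : ℤ) : (spinorSeries d d' α * f).coeff l =
      ∑ a : Set.Icc d d', if a.1.weight = α then
        MvPolynomial.X a * f.coeff (l - a.1.level) else 0 := by
  rw [spinorSeries, Finset.sum_mul, AddMonoidAlgebra.coeff_sum, Finsupp.finsetSum_apply]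
  refine Finset.sum_congr rfl fun a _ => ?_
  split_ifs with h
  · rw [← LaurentPolynomial.single_eq_C_mul_T]
    exact AddMonoidAlgebra.coeff_single_mul_eq_mul_coeff _ fun m _ => by omega
  · rw [zero_mul]; rfl

theorem coeff_spinorSeries (α : SpinorWeight) (l : ℤ) :
    (spinorSeries d d' α).coeff l =
      ∑ a : Set.Icc d d', if a.1.weight = α ∧ a.1.level = l then MvPolynomial.X a else 0 := by
  rw [spinorSeries, AddMonoidAlgebra.coeff_sum, Finsupp.finsetSum_apply]
  refine Finset.sum_congr rfl fun a _ => ?_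
  rw [ite_and]
  split_ifs with h h' <;> try rfl
  · rw [← LaurentPolynomial.single_eq_C_mul_T, h']
    exact Finsupp.single_eq_same
  · rw [← LaurentPolynomial.single_eq_C_mul_T]
    exact Finsupp.single_eq_of_ne (Ne.symm h')

/-- The pairs of generators that occur in `Γ^{sˡ}`. -/
noncomputable def quadricTerms (d d' : AffineWeight) (s : VectorWeight) (l : ℤ) :
    Finset (Set.Icc d d' × Set.Icc d d') :=
  Finset.univ.filter fun p =>
    (p.1.1.weight, p.2.1.weight) ∈ s.pairs ∧ p.1.1.level + p.2.1.level = l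

theorem mem_quadricTerms {s : VectorWeight} {l : ℤ} {p : Set.Icc d d' × Set.Icc d d'} :
    p ∈ quadricTerms d d' s l ↔
      (p.1.1.weight, p.2.1.weight) ∈ s.pairs ∧ p.1.1.level + p.2.1.level = l := by
  simp [quadricTerms]

theorem affineQuadric_eq_sum (s : VectorWeight) (l : ℤ) :
    affineQuadric d d' s l = ∑ p ∈ quadricTerms d d' s l,
      s.sign p.1.1.weight • (MvPolynomial.X p.1 * MvPolynomial.X p.2) := by
  have h : ∀ r ∈ s.pairs, (s.sign r.1 •
      (spinorSeries d d' r.1 * spinorSeries d d' r.2)).coeff l =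
      ∑ p : Set.Icc d d' × Set.Icc d d', if (p.1.1.weight, p.2.1.weight) = r ∧
        p.1.1.level + p.2.1.level = l then
          s.sign p.1.1.weight • (MvPolynomial.X p.1 * MvPolynomial.X p.2) else 0 := by
    rintro ⟨α, β⟩ -
    have : (s.sign α • (spinorSeries d d' α * spinorSeries d d' β)).coeff l =
        s.sign α • (spinorSeries d d' α * spinorSeries d d' β).coeff l := rfl
    rw [this, coeff_spinorSeries_mul, Fintype.sum_prod_type, Finset.smul_sum]
    refine Finset.sum_congr rfl fun a _ => ?_
    rw [coeff_spinorSeries]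
    split_ifs with ha
    · rw [Finset.mul_sum, Finset.smul_sum]
      refine Finset.sum_congr rfl fun b _ => ?_
      rw [mul_ite, mul_zero, smul_ite, smul_zero]
      subst ha
      refine if_congr ?_ rfl rfl
      simp only [Prod.mk.injEq, true_and]
      exact and_congr_right fun _ => by omega
    · rw [smul_zero]
      refine (Finset.sum_eq_zero fun b _ => if_neg ?_).symm
      rintro ⟨h, -⟩
      exact ha (Prod.mk.inj h).1
  rw [affineQuadric, gammaQuadric_eq_sum, AddMonoidAlgebra.coeff_sum, Finsupp.finsetSum_apply,
    Finset.sum_congr rfl h, Finset.sum_comm, quadricTerms, Finset.sum_filter]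
  refine Finset.sum_congr rfl fun p _ => ?_
  simp only [ite_and, Finset.sum_ite_eq]

/-- A coefficient of the identity `sum_syzygy` at the truncated series. It involves only generators
of the interval, so no boundary corrections arise. -/
theorem sum_syzygy_affineQuadric {z : List (ℤˣ × SpinorWeight × VectorWeight)}
    (hz : z ∈ syzygies) (l : ℤ) :
    ∑ p ∈ z.toFinset ×ˢ (Finset.univ : Finset (Set.Icc d d')), (if p.2.1.weight = p.1.2.1 then
      p.1.1 • (MvPolynomial.X p.2 * affineQuadric d d' p.1.2.2 (l - p.2.1.level)) else 0) = 0 := by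
  have hnd : ∀ z ∈ syzygies, z.Nodup := by decide +kernel
  have h := congrArg (fun f => f.coeff l) (sum_syzygy (spinorSeries d d') z hz)
  rw [← List.sum_toFinset _ (hnd z hz)] at h
  rw [AddMonoidAlgebra.coeff_sum, Finsupp.finsetSum_apply] at h
  rw [Finset.sum_product]
  refine Eq.trans (Finset.sum_congr rfl fun t _ => ?_) h
  have : (t.1 • (spinorSeries d d' t.2.1 * gammaQuadric t.2.2 (spinorSeries d d'))).coeff l =
    t.1 • (spinorSeries d d' t.2.1 * gammaQuadric t.2.2 (spinorSeries d d')).coeff l := rfl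
  rw [this, coeff_spinorSeries_mul, Finset.smul_sum]
  refine Finset.sum_congr rfl fun a _ => ?_
  rw [smul_ite, smul_zero]
  rfl

/-- The clutter of `Γ^{sˡ}` lies in the interval. -/
def ClutterMem (d d' : AffineWeight) (t : VectorWeight × ℤ) : Prop :=
  (clutter t.1 t.2).1 ∈ Set.Icc d d' ∧ (clutter t.1 t.2).2 ∈ Set.Icc d d'

/-- In a monomial other than the clutter, one factor is at most the meet and the other at least the
join, so the clutter lies between two elements of the interval. -/
theorem clutterMem_of_mem_quadricTerms {s : VectorWeight} {l : ℤ}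
    {p : Set.Icc d d' × Set.Icc d d'} (hp : p ∈ quadricTerms d d' s l) :
    ClutterMem d d' (s, l) := by
  obtain ⟨h₁, h₂⟩ := mem_quadricTerms.1 hp
  have h₃ := eq_clutter_or h₁ h₂
  have h₄ := clutter_rectangle s l
  have ha := p.1.2
  have hb := p.2.2
  simp only [ClutterMem, Set.mem_Icc, AffineWeight.le_iff] at ha hb ⊢
  simp only [Prod.ext_iff, AffineWeight.eq_iff, AffineWeight.lt_iff] at h₃
  omega

theorem affineQuadric_eq_zero {s : VectorWeight} {l : ℤ} (h : ¬ ClutterMem d d' (s, l)) :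
    affineQuadric d d' s l = 0 := by
  rw [affineQuadric_eq_sum]
  exact Finset.sum_eq_zero fun p hp => absurd (clutterMem_of_mem_quadricTerms hp) h

theorem clutter_mem_quadricTerms {s : VectorWeight} {l : ℤ} (h : ClutterMem d d' (s, l)) :
    ((⟨_, h.1⟩, ⟨_, h.2⟩) : Set.Icc d d' × Set.Icc d d') ∈ quadricTerms d d' s l :=
  mem_quadricTerms.2 ⟨mem_pairs_clutter s l, level_clutter s l⟩

theorem IsStraighteningRelation.symm {q : IntervalPoly d d'} {α β : Set.Icc d d'}
    (h : IsStraighteningRelation q α β) : IsStraighteningRelation q β α := by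
  obtain ⟨m, j, hm, hj, S, c, ε, η, hS, hq⟩ := h
  exact ⟨m, j, Set.pair_comm α.1 β.1 ▸ hm, Set.pair_comm α.1 β.1 ▸ hj, S, c, ε, η, hS,
    by rw [hq, mul_comm (MvPolynomial.X α)]⟩

theorem isStraighteningRelation_affineQuadric {s : VectorWeight} {l : ℤ}
    (h : ClutterMem d d' (s, l)) :
    IsStraighteningRelation (affineQuadric d d' s l) ⟨_, h.1⟩ ⟨_, h.2⟩ := by
  classical
  set α : Set.Icc d d' := ⟨_, h.1⟩ with hα
  set β : Set.Icc d d' := ⟨_, h.2⟩ with hβ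
  have hG := isGLB_clutter s l
  have hL := isLUB_clutter s l
  have hαβ : ∀ x ∈ ({(clutter s l).1, (clutter s l).2} : Set AffineWeight), d ≤ x ∧ x ≤ d' := by
    rintro x (rfl | rfl)
    exacts [h.1, h.2]
  obtain ⟨m, hm⟩ : ∃ m : Set.Icc d d', m.1 = (meetJoin s l).1 :=
    ⟨⟨_, hG.2 fun x hx => (hαβ x hx).1, (hG.1 (Set.mem_insert _ _)).trans h.1.2⟩, rfl⟩
  obtain ⟨j, hj⟩ : ∃ j : Set.Icc d d', j.1 = (meetJoin s l).2 :=
    ⟨⟨_, h.1.1.trans (hL.1 (Set.mem_insert _ _)), hL.2 fun x hx => (hαβ x hx).2⟩, rfl⟩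
  have h₀ : (α, β) ∈ quadricTerms d d' s l := clutter_mem_quadricTerms h
  obtain ⟨p, hp, hpm⟩ : ∃ p ∈ quadricTerms d d' s l, p = (m, j) ∨ p = (j, m) := by
    have hl := level_meetJoin s l
    rw [← hm, ← hj] at hl
    rcases mem_pairs_meetJoin s l with h | h <;> rw [← hm, ← hj] at h
    · exact ⟨_, mem_quadricTerms.2 ⟨h, hl⟩, Or.inl rfl⟩
    · exact ⟨_, mem_quadricTerms.2 ⟨h, by rwa [add_comm] at hl⟩, Or.inr rfl⟩
  have hr := clutter_rectangle s l
  have hpne : p ≠ (α, β) := by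
    rintro rfl
    have h₁ : m.1 ≤ j.1 := by
      rw [hm, hj, AffineWeight.le_iff]; omega
    have h₂ := not_le_clutter s l
    have h₃ := not_ge_clutter s l
    rcases hpm with h | h <;> rw [Prod.mk.injEq] at h <;> rw [← h.1, ← h.2] at h₁
    · exact h₂ h₁
    · exact h₃ h₁
  set T := ((quadricTerms d d' s l).erase (α, β)).erase p with hT
  -- `o` puts the smaller factor first, since the order of the factors in `pairs` need not follow
  -- the order of `Ê`.
  let o : Set.Icc d d' × Set.Icc d d' → Set.Icc d d' × Set.Icc d d' := fun p =>
    if p.1 ≤ p.2 then p else p.swap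
  have ho : ∀ p, o p = p ∨ o p = p.swap := fun p => ite_eq_or_eq _ _ _
  have hTmem : ∀ r ∈ T, r ∈ quadricTerms d d' s l := fun r hr =>
    Finset.mem_of_mem_erase (Finset.mem_of_mem_erase hr)
  have hswap : ∀ r ∈ T, (r.2.1.weight, r.1.1.weight) ∉ s.pairs := fun r hr =>
    swap_notMem_pairs s _ (mem_quadricTerms.1 (hTmem r hr)).1
  have hinj : Set.InjOn o T := by
    intro r hr r' hr' he
    have key : ∀ r ∈ T, r.swap ∉ T := fun r hr hr' =>
      hswap _ hr (mem_quadricTerms.1 (hTmem _ hr')).1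
    rcases ho r with h | h <;> rcases ho r' with h' | h' <;> rw [h, h'] at he
    · exact he
    · exact absurd (he ▸ hr) (key r' hr')
    · exact absurd (he ▸ hr') (key r hr)
    · exact Prod.swap_injective he
  -- The sign of a monomial is indexed by its first factor as listed in `s.pairs`, so the
  -- coefficient has to undo the reorientation. The factor `relSign s l` normalizes the clutter to
  -- coefficient one.
  refine ⟨m, j, hm ▸ hG, hj ▸ hL, T.image o, fun r =>
    relSign s l * if (r.1.1.weight, r.2.1.weight) ∈ s.pairs then s.sign r.1.1.weight
      else s.sign r.2.1.weight, relSign s l, relSign s l * s.sign p.1.1.weight, ?_, ?_⟩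
  · intro r hr'
    obtain ⟨r, hrT, rfl⟩ := Finset.mem_image.1 hr'
    have h₁ := eq_clutter_or (mem_quadricTerms.1 (hTmem r hrT)).1
      (mem_quadricTerms.1 (hTmem r hrT)).2
    have hr₁ : r ≠ (α, β) := Finset.ne_of_mem_erase (Finset.mem_of_mem_erase hrT)
    have hr₂ : r ≠ p := Finset.ne_of_mem_erase hrT
    have hmj : m.1 ≤ j.1 := by rw [hm, hj, AffineWeight.le_iff]; omega
    have hr₃ : ¬ (r = (m, j) ∨ r = (j, m)) := by
      rintro (h' | h') <;> rcases hpm with h'' | h''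
      · exact hr₂ (h'.trans h''.symm)
      · refine hswap r hrT ?_
        have := (mem_quadricTerms.1 hp).1
        rw [h''] at this
        rwa [h']
      · refine hswap r hrT ?_
        have := (mem_quadricTerms.1 hp).1
        rw [h''] at this
        rwa [h']
      · exact hr₂ (h'.trans h''.symm)
    rw [← hm, ← hj] at h₁
    rcases h₁ with h₁ | h₁ | h₁ | ⟨h₁, h₂⟩ | ⟨h₁, h₂⟩
    · exact absurd (Prod.ext (Subtype.ext (congrArg Prod.fst h₁))
        (Subtype.ext (congrArg Prod.snd h₁))) hr₁
    · exact absurd (Or.inl (Prod.ext (Subtype.ext ((congrArg Prod.fst h₁).trans hm.symm))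
        (Subtype.ext ((congrArg Prod.snd h₁).trans hj.symm)))) hr₃
    · exact absurd (Or.inr (Prod.ext (Subtype.ext ((congrArg Prod.snd h₁).trans hj.symm))
        (Subtype.ext ((congrArg Prod.fst h₁).trans hm.symm)))) hr₃
    · have : o r = r := if_pos ((h₁.trans_le hmj).trans h₂).le
      rw [this]
      exact ⟨h₁, h₂⟩
    · have : o r = r.swap := if_neg (not_le_of_gt ((h₁.trans_le hmj).trans h₂))
      rw [this]
      exact ⟨h₁, h₂⟩
  · rw [affineQuadric_eq_sum, ← Finset.add_sum_erase _ _ h₀,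
      ← Finset.add_sum_erase _ _ (Finset.mem_erase.2 ⟨hpne, hp⟩), smul_add, smul_add, smul_smul,
      smul_smul, ← add_assoc]
    congr 1
    · congr 1
      · have : relSign s l * s.sign α.1.weight = 1 := Int.units_mul_self _
        rw [this, one_smul]
      · rcases hpm with rfl | rfl
        · rfl
        · rw [mul_comm (MvPolynomial.X j)]
    · rw [Finset.sum_image hinj, Finset.smul_sum]
      refine Finset.sum_congr rfl fun r hr => ?_
      have h₁ := (mem_quadricTerms.1 (hTmem r hr)).1
      rw [smul_smul]
      rcases ho r with h | h <;> rw [h] <;> beta_reduce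
      · rw [if_pos h₁]
      · rw [Prod.fst_swap, Prod.snd_swap, if_neg (hswap r hr), mul_comm (MvPolynomial.X r.2)]

end AffineQuadrics

/-! ### The quadrics form a Gröbner basis -/

section GroebnerBasis

open VectorWeight MvPolynomial

/-- A strictly concave function of the height, as a weight of the generators. -/
noncomputable def intervalWeight (d d' : AffineWeight) (a : Set.Icc d d') : ℕ :=
  ((a.1.ht - d.ht) * (d'.ht - a.1.ht)).toNat

theorem intervalWeight_cast {d d' : AffineWeight} (a : Set.Icc d d') :
    (intervalWeight d d' a : ℤ) = (a.1.ht - d.ht) * (d'.ht - a.1.ht) := by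
  have h₁ := AffineWeight.ht_mono a.2.1
  have h₂ := AffineWeight.ht_mono a.2.2
  exact Int.toNat_of_nonneg (mul_nonneg (by omega) (by omega))

/-- The labels of the nonzero quadrics. -/
abbrev RelationIndex (d d' : AffineWeight) : Type :=
  {t : VectorWeight × ℤ // ClutterMem d d' t}

variable {d d' : AffineWeight}

/-- The clutter of a nonzero quadric, as a pair of elements of the interval. -/
def RelationIndex.pair (t : RelationIndex d d') : Set.Icc d d' × Set.Icc d d' :=
  (⟨_, t.2.1⟩, ⟨_, t.2.2⟩)

/-- The nonzero quadric with the sign for which the clutter has coefficient one. -/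
noncomputable def monicQuadric (t : RelationIndex d d') : IntervalPoly d d' :=
  relSign t.1.1 t.1.2 • affineQuadric d d' t.1.1 t.1.2

/-- The exponent of the product of two generators. -/
noncomputable def pairExponent {H : Type*} (p : H × H) : H →₀ ℕ :=
  Finsupp.single p.1 1 + Finsupp.single p.2 1

theorem weight_pairExponent {H : Type*} (w : H → ℕ) (p : H × H) :
    Finsupp.weight w (pairExponent p) = w p.1 + w p.2 := by
  rw [pairExponent, map_add, Finsupp.weight_single, Finsupp.weight_single, one_smul, one_smul]

theorem pairExponent_swap {H : Type*} (p : H × H) : pairExponent p.swap = pairExponent p :=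
  add_comm _ _

theorem monomial_pairExponent {H k : Type*} [CommRing k] (p : H × H) :
    monomial (pairExponent p) (1 : k) = X p.1 * X p.2 := by
  rw [X, X, monomial_mul, one_mul, pairExponent]

theorem affineQuadric_eq_smul (t : RelationIndex d d') :
    affineQuadric d d' t.1.1 t.1.2 = relSign t.1.1 t.1.2 • monicQuadric t := by
  rw [monicQuadric, smul_smul, Int.units_mul_self, one_smul]

theorem span_monicQuadric :
    Ideal.span (Set.range (monicQuadric (d := d) (d' := d'))) = quadricIdeal d d' := by
  refine le_antisymm (Ideal.span_le.2 ?_) (Ideal.span_le.2 ?_)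
  · rintro _ ⟨t, rfl⟩
    rw [monicQuadric, Units.smul_def]
    exact zsmul_mem (Ideal.subset_span (by exact ⟨t.1, rfl⟩)) _
  · rintro _ ⟨t, rfl⟩
    by_cases h : ClutterMem d d' t
    · change affineQuadric d d' t.1 t.2 ∈ _
      rw [affineQuadric_eq_smul ⟨t, h⟩, Units.smul_def]
      exact zsmul_mem (Ideal.subset_span (Set.mem_range_self _)) _
    · change affineQuadric d d' t.1 t.2 ∈ _
      rw [affineQuadric_eq_zero h]
      exact Submodule.zero_mem _

theorem units_smul_mem {k M : Type*} [CommRing k] [AddCommGroup M] [Module k M]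
    (N : Submodule k M) (u : ℤˣ) {x : M} (hx : x ∈ N) : u • x ∈ N := by
  rw [Units.smul_def]
  exact zsmul_mem hx _

theorem monicQuadric_sub_mem_weightLT (t : RelationIndex d d') :
    monicQuadric t - monomial (pairExponent t.pair) 1 ∈
      weightLT (intervalWeight d d') ℂ
        (Finsupp.weight (intervalWeight d d') (pairExponent t.pair)) := by
  classical
  have h₀ : t.pair ∈ quadricTerms d d' t.1.1 t.1.2 := clutter_mem_quadricTerms t.2
  have h₁ : relSign t.1.1 t.1.2 * t.1.1.sign t.pair.1.1.weight = 1 := Int.units_mul_self _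
  rw [monicQuadric, affineQuadric_eq_sum, ← Finset.add_sum_erase _ _ h₀, smul_add, smul_smul, h₁,
    one_smul, monomial_pairExponent, add_sub_cancel_left]
  refine units_smul_mem _ _ (Submodule.sum_mem _ fun p hp => units_smul_mem _ _ ?_)
  rw [← monomial_pairExponent]
  refine monomial_mem_weightLT ?_ _
  rw [weight_pairExponent, weight_pairExponent]
  obtain ⟨hne, hp⟩ := Finset.mem_erase.1 hp
  obtain ⟨h₂, h₃⟩ := mem_quadricTerms.1 hp
  obtain ⟨h₄, h₅⟩ := ht_le_of_mem_pairs h₂ h₃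
  rcases h₅ with h₅ | h₅
  · exact absurd (Prod.ext (Subtype.ext (congrArg Prod.fst h₅))
      (Subtype.ext (congrArg Prod.snd h₅))) hne
  · zify
    simp only [intervalWeight_cast]
    change _ < ((clutter t.1.1 t.1.2).1.ht - _) * (_ - (clutter t.1.1 t.1.2).1.ht) +
      ((clutter t.1.1 t.1.2).2.ht - _) * (_ - (clutter t.1.1 t.1.2).2.ht)
    -- The weight is `-ht² + (d.ht + d'.ht) * ht` plus a constant; the linear parts agree by `h₄`,
    -- and the squares decide by `h₅`.
    linear_combination h₅ + (d.ht + d'.ht) * h₄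

theorem sum_pair_mem {α k M : Type*} [CommRing k] [AddCommGroup M] [Module k M]
    (N : Submodule k M) {P : Finset α} {F : α → M} (hF : ∑ p ∈ P, F p = 0) {p p' : α}
    (hp : p ∈ P) (hp' : p' ∈ P) (hne : p ≠ p') (h : ∀ r ∈ P, r ≠ p → r ≠ p' → F r ∈ N) :
    F p + F p' ∈ N := by
  classical
  rw [← Finset.add_sum_erase _ _ hp,
    ← Finset.add_sum_erase _ _ (Finset.mem_erase.2 ⟨hne.symm, hp'⟩), ← add_assoc] at hF
  rw [eq_neg_of_add_eq_zero_left hF]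
  exact N.neg_mem (N.sum_mem fun r hr => h r
    (Finset.mem_of_mem_erase (Finset.mem_of_mem_erase hr))
    (Finset.ne_of_mem_erase (Finset.mem_of_mem_erase hr)) (Finset.ne_of_mem_erase hr))

theorem mem_orderings_pair {t : RelationIndex d d'} {u : Set.Icc d d' × Set.Icc d d'}
    (hu : u = t.pair ∨ u = t.pair.swap) :
    (u.1.1, u.2.1) ∈ orderings (clutter t.1.1 t.1.2) := by
  rw [mem_orderings]
  exact hu.imp (fun h => by rw [h]; rfl) (fun h => by rw [h]; rfl)

/-- The overlap of two clutters with a common element resolves by a linear syzygy. -/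
theorem overlap_mem_lowerSpan {t t' : RelationIndex d d'} {u v : Set.Icc d d' × Set.Icc d d'}
    (hu : u = t.pair ∨ u = t.pair.swap) (hv : v = t'.pair ∨ v = t'.pair.swap) (huv : u.1 = v.1)
    (hne : u.2 ≠ v.2) :
    X v.2 * monicQuadric t - X u.2 * monicQuadric t' ∈
      lowerSpan (k := ℂ) (intervalWeight d d') monicQuadric (fun t => pairExponent t.pair)
        (Finsupp.weight (intervalWeight d d') (Finsupp.single v.2 1 + pairExponent t.pair)) := by
  classical
  obtain ⟨hL, z, hz, r, hr, r', hr', h₁, h₂, h₃, h₄⟩ := exists_syzygy (mem_orderings_pair hu)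
    (mem_orderings_pair hv) (congrArg Subtype.val huv) (fun h => hne (Subtype.ext h))
  dsimp only at hL h₁ h₂ h₄
  obtain ⟨ε, α, s⟩ := r
  obtain ⟨ε', α', s'⟩ := r'
  simp only [Prod.mk.injEq] at h₁ h₂
  obtain ⟨rfl, rfl⟩ := h₁
  obtain ⟨rfl, rfl⟩ := h₂
  dsimp only at h₃
  set N := lowerSpan (k := ℂ) (intervalWeight d d') monicQuadric
    (fun t : RelationIndex d d' => pairExponent t.pair)
    (Finsupp.weight (intervalWeight d d') (Finsupp.single v.2 1 + pairExponent t.pair)) with hN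
  have key := sum_pair_mem N (sum_syzygy_affineQuadric hz (v.2.1.level + t.1.2))
    (p := ((ε, v.2.1.weight, t.1.1), v.2)) (p' := ((ε', u.2.1.weight, t'.1.1), u.2))
    (Finset.mem_product.2 ⟨List.mem_toFinset.2 hr, Finset.mem_univ _⟩)
    (Finset.mem_product.2 ⟨List.mem_toFinset.2 hr', Finset.mem_univ _⟩)
    (fun h => hne (congrArg Prod.snd h).symm) ?_
  -- The opposite leading signs `h₃` turn the sum of the two leading terms of the syzygy, up to
  -- sign, into the difference in the goal.
  · dsimp only at key
    rw [if_pos rfl, if_pos rfl, add_sub_cancel_left, hL, add_sub_cancel_left,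
      affineQuadric_eq_smul t, affineQuadric_eq_smul t', mul_smul_comm, mul_smul_comm, smul_smul,
      smul_smul, h₃, Units.neg_smul, neg_add_eq_sub, ← smul_sub] at key
    have := units_smul_mem N (-(ε' * relSign t'.1.1 t'.1.2)) key
    rwa [smul_smul, neg_mul, Int.units_mul_self, Units.neg_smul, one_smul, neg_sub] at this
  · rintro ⟨⟨η, β, s⟩, a⟩ hp hne₁ hne₂
    dsimp only
    split_ifs with ha
    swap
    · exact N.zero_mem
    refine units_smul_mem _ _ ?_
    subst ha
    -- A remaining term either contains a vanishing quadric or is a multiple of a relation with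
    -- greater energy, hence with smaller weight.
    by_cases hmem : ClutterMem d d' (s, v.2.1.level + t.1.2 - a.1.level)
    swap
    · rw [affineQuadric_eq_zero hmem, mul_zero]
      exact N.zero_mem
    have hE := h₄ _ (List.mem_toFinset.1 (Finset.mem_product.1 hp).1) a.1.level
    rcases hE with ⟨h, h'⟩ | ⟨h, h'⟩ | ⟨h, h'⟩
    · refine absurd (Prod.ext h (Subtype.ext (AffineWeight.ext ?_ h'))) hne₁
      exact congrArg (fun p => p.2.1) h
    · refine absurd (Prod.ext h (Subtype.ext (AffineWeight.ext ?_ h'))) hne₂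
      exact congrArg (fun p => p.2.1) h
    · have hq := affineQuadric_eq_smul ⟨_, hmem⟩
      dsimp only at hq
      rw [hq, mul_smul_comm]
      refine units_smul_mem _ _ (Submodule.subset_span ⟨Finsupp.single a 1, ⟨_, hmem⟩, ?_, rfl⟩)
      rw [map_add, map_add, weight_pairExponent, weight_pairExponent, Finsupp.weight_single,
        Finsupp.weight_single, one_smul, one_smul]
      zify
      simp only [intervalWeight_cast, RelationIndex.pair]
      simp only [totalHt, energy] at h h'
      change (a.1.ht - _) * (_ - a.1.ht) + _ < _
      linear_combination h' + (d.ht + d'.ht) * h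

/-- After removal of a common cofactor `c`, distinct clutters either share exactly one element,
where a linear syzygy applies, or are coprime, where the Koszul syzygy applies. -/
theorem monicQuadric_overlap (t t' : RelationIndex d d') (n n' : Set.Icc d d' →₀ ℕ)
    (h : n + pairExponent t.pair = n' + pairExponent t'.pair) :
    monomial n 1 * monicQuadric t - monomial n' 1 * monicQuadric t' ∈
      lowerSpan (k := ℂ) (intervalWeight d d') monicQuadric (fun t => pairExponent t.pair)
        (Finsupp.weight (intervalWeight d d') (n + pairExponent t.pair)) := by
  classical
  by_cases htt : t = t'
  · subst htt
    rw [add_right_cancel h, sub_self]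
    exact Submodule.zero_mem _
  by_cases hs : ∃ u v : Set.Icc d d' × Set.Icc d d', (u = t.pair ∨ u = t.pair.swap) ∧
      (v = t'.pair ∨ v = t'.pair.swap) ∧ u.1 = v.1
  · obtain ⟨u, v, hu, hv, huv⟩ := hs
    have hne : u.2 ≠ v.2 := by
      intro h₂
      have huv' : u = v := Prod.ext huv h₂
      have := eq_of_mem_orderings (mem_orderings_pair hu) (huv' ▸ mem_orderings_pair hv)
      exact htt (Subtype.ext (Prod.ext this.1 this.2))
    have hu' : pairExponent t.pair = pairExponent u := by
      rcases hu with rfl | rfl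
      · rfl
      · rw [pairExponent_swap]
    have hv' : pairExponent t'.pair = pairExponent v := by
      rcases hv with rfl | rfl
      · rfl
      · rw [pairExponent_swap]
    obtain ⟨c, rfl⟩ : ∃ c, n = Finsupp.single v.2 1 + c := by
      refine exists_add_of_le (Finsupp.single_le_iff.2 ?_)
      rw [hu', hv', pairExponent, pairExponent, huv] at h
      have := DFunLike.congr_fun h v.2
      simp only [Finsupp.add_apply, Finsupp.single_eq_same, Finsupp.single_eq_of_ne hne.symm]
        at this
      omega
    obtain rfl : n' = Finsupp.single u.2 1 + c := by
      rw [hu', hv', pairExponent, pairExponent, huv] at h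
      refine add_right_cancel (b := Finsupp.single v.1 1 + Finsupp.single v.2 1) ?_
      rw [← h]
      abel
    have := monomial_mul_mem_lowerSpan (overlap_mem_lowerSpan hu hv huv hne) c
    rw [← map_add] at this
    have hw : Finsupp.single v.2 1 + c + pairExponent t.pair =
        c + (Finsupp.single v.2 1 + pairExponent t.pair) := by abel
    rw [hw, add_comm _ c, add_comm _ c, ← one_mul (1 : ℂ), ← monomial_mul, ← monomial_mul,
      mul_assoc, mul_assoc, ← mul_sub]
    exact this
  · obtain ⟨c, rfl⟩ : ∃ c, n = pairExponent t'.pair + c := by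
      refine exists_add_of_le fun x => ?_
      by_cases hx : x = t'.pair.1 ∨ x = t'.pair.2
      · have h₀ : pairExponent t.pair x = 0 := by
          have : x ≠ t.pair.1 ∧ x ≠ t.pair.2 := by
            constructor <;> intro h₁ <;> rcases hx with h₂ | h₂
            · exact hs ⟨t.pair, t'.pair, Or.inl rfl, Or.inl rfl, h₁.symm.trans h₂⟩
            · exact hs ⟨t.pair, t'.pair.swap, Or.inl rfl, Or.inr rfl, h₁.symm.trans h₂⟩
            · exact hs ⟨t.pair.swap, t'.pair, Or.inr rfl, Or.inl rfl, h₁.symm.trans h₂⟩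
            · exact hs ⟨t.pair.swap, t'.pair.swap, Or.inr rfl, Or.inr rfl, h₁.symm.trans h₂⟩
          rw [pairExponent, Finsupp.add_apply, Finsupp.single_eq_of_ne this.1,
            Finsupp.single_eq_of_ne this.2, add_zero]
        have := DFunLike.congr_fun h x
        rw [Finsupp.add_apply, Finsupp.add_apply, h₀] at this
        omega
      · push Not at hx
        rw [pairExponent, Finsupp.add_apply, Finsupp.single_eq_of_ne hx.1,
          Finsupp.single_eq_of_ne hx.2]
        exact Nat.zero_le _
    obtain rfl : n' = pairExponent t.pair + c := by
      refine add_right_cancel (b := pairExponent t'.pair) ?_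
      rw [← h]
      abel
    have := monomial_mul_mem_lowerSpan (koszul_mem_lowerSpan
      (e := fun t : RelationIndex d d' => pairExponent t.pair)
      monicQuadric_sub_mem_weightLT t t') c
    rw [← map_add] at this
    have hw : pairExponent t'.pair + c + pairExponent t.pair =
        c + (pairExponent t.pair + pairExponent t'.pair) := by abel
    rw [hw, add_comm _ c, add_comm _ c, ← one_mul (1 : ℂ), ← monomial_mul, ← monomial_mul,
      mul_assoc, mul_assoc, ← mul_sub]
    exact this

/-! ### Multichains as the exponents that avoid all clutters -/

theorem exists_relationIndex {α β : Set.Icc d d'} (h₁ : ¬ α ≤ β) (h₂ : ¬ β ≤ α) :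
    ∃ t : RelationIndex d d', (α, β) = t.pair ∨ (β, α) = t.pair := by
  obtain ⟨s, l, h⟩ := exists_clutter (a := α.1) (b := β.1) h₁ h₂
  have hmem : ClutterMem d d' (s, l) := by
    rcases h with h | h <;> simp only [ClutterMem, ← h]
    · exact ⟨α.2, β.2⟩
    · exact ⟨β.2, α.2⟩
  refine ⟨⟨(s, l), hmem⟩, h.imp (fun h => ?_) (fun h => ?_)⟩
  · exact Prod.ext (Subtype.ext (congrArg Prod.fst h)) (Subtype.ext (congrArg Prod.snd h))
  · exact Prod.ext (Subtype.ext (congrArg Prod.fst h)) (Subtype.ext (congrArg Prod.snd h))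

theorem not_pairExponent_le_listExponent (l : Multichain (Set.Icc d d'))
    (t : RelationIndex d d') : ¬ pairExponent t.pair ≤ listExponent l.1 := by
  intro h
  have h₁ : t.pair.1 ∈ l.1 := mem_of_le_listExponent (le_trans le_self_add h)
  have h₂ : t.pair.2 ∈ l.1 := mem_of_le_listExponent (le_trans le_add_self h)
  have h₃ : t.pair.1 ≤ t.pair.2 ∨ t.pair.2 ≤ t.pair.1 := by
    have : Std.Symm fun a b : Set.Icc d d' => a ≤ b ∨ b ≤ a := ⟨fun _ _ h => h.symm⟩
    have hp : l.1.Pairwise fun a b => a ≤ b ∨ b ≤ a := l.2.imp fun h => Or.inl h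
    exact List.Pairwise.forall_of_forall (R := fun a b : Set.Icc d d' => a ≤ b ∨ b ≤ a)
      (fun a _ => Or.inl le_rfl) hp h₁ h₂
  rcases h₃ with h₃ | h₃
  · exact not_le_clutter _ _ h₃
  · exact not_ge_clutter _ _ h₃

theorem exists_multichain_of_not_pairExponent_le (m : Set.Icc d d' →₀ ℕ)
    (h : ∀ t : RelationIndex d d', ¬ pairExponent t.pair ≤ m) :
    ∃ l : Multichain (Set.Icc d d'), listExponent l.1 = m := by
  classical
  refine exists_multichain fun a ha b hb => ?_
  by_contra! hab
  have hle : pairExponent (a, b) ≤ m := by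
    intro x
    have hne : a ≠ b := fun h => hab.1 h.le
    have ha' := Nat.pos_of_ne_zero (Finsupp.mem_support_iff.1 ha)
    have hb' := Nat.pos_of_ne_zero (Finsupp.mem_support_iff.1 hb)
    rw [pairExponent, Finsupp.add_apply, Finsupp.single_apply, Finsupp.single_apply]
    dsimp only
    split_ifs with h₁ h₂ h₂
    · exact absurd (h₁.trans h₂.symm) hne
    · rw [← h₁]; omega
    · rw [← h₂]; omega
    · omega
  obtain ⟨t, ht | ht⟩ := exists_relationIndex hab.1 hab.2
  · exact h t (ht ▸ hle)
  · exact h t (ht ▸ (pairExponent_swap (a, b)).trans_le hle)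

end GroebnerBasis

/-! ### The straightened law and the corollary -/

/-- No iteration is needed: every monomial of the relation except the clutter is already a chain of
length two that starts at or below the meet, so solving for the clutter gives the expansion. -/
theorem IsStraighteningRelation.exists_expansion {d d' : AffineWeight} {q : IntervalPoly d d'}
    {α β : Set.Icc d d'} (h : IsStraighteningRelation q α β) (hq : q ∈ quadricIdeal d d') :
    ∃ c : Multichain (Set.Icc d d') →₀ ℂ,
      intervalGenerator d d' α * intervalGenerator d d' β =
        c.sum (fun l r => r • standardMonomial (intervalGenerator d d') l) ∧
      ∀ l ∈ c.support, ∃ (γ : Set.Icc d d') (l' : List (Set.Icc d d')),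
        l.1 = γ :: l' ∧ γ ≤ α ∧ γ ≤ β := by
  obtain ⟨m, j, hm, hj, S, c, ε, η, hS, hrel⟩ := h
  let good : Set (Multichain (Set.Icc d d')) := {l | ∃ (γ : Set.Icc d d')
    (l' : List (Set.Icc d d')), l.1 = γ :: l' ∧ γ ≤ α ∧ γ ≤ β}
  let N := Submodule.span ℂ (standardMonomial (intervalGenerator d d') '' good)
  have hmα : m ≤ α := hm.1 (Set.mem_insert _ _)
  have hmβ : m ≤ β := hm.1 (Set.mem_insert_of_mem _ (Set.mem_singleton _))
  have hαj : α ≤ j := hj.1 (Set.mem_insert _ _)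
  have hpair : ∀ γ γ' : Set.Icc d d', γ ≤ m → j ≤ γ' →
      Ideal.Quotient.mk (quadricIdeal d d') (MvPolynomial.X γ * MvPolynomial.X γ') ∈ N := by
    intro γ γ' h₁ h₂
    refine Submodule.subset_span ⟨⟨[γ, γ'], ?_⟩, ⟨γ, [γ'], rfl, h₁.trans hmα, h₁.trans hmβ⟩, ?_⟩
    · exact List.pairwise_pair.2 (((h₁.trans hmα).trans hαj).trans h₂)
    · rw [standardMonomial, List.map_cons, List.map_cons, List.map_nil, List.prod_cons,
        List.prod_singleton, map_mul]
      rfl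
  have hunit : ∀ (u : ℤˣ) (x : IntervalPoly d d'),
      Ideal.Quotient.mk (quadricIdeal d d') (u • x) =
        u • Ideal.Quotient.mk (quadricIdeal d d') x := by
    intro u x
    rw [Units.smul_def, Units.smul_def, map_zsmul]
  have hmem : intervalGenerator d d' α * intervalGenerator d d' β ∈ N := by
    have h := congrArg (Ideal.Quotient.mk (quadricIdeal d d')) hrel
    rw [hunit, Ideal.Quotient.eq_zero_iff_mem.2 hq, smul_zero, map_add, map_add, map_sum,
      map_mul, add_assoc] at h
    rw [intervalGenerator, intervalGenerator, eq_neg_of_add_eq_zero_left h.symm]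
    refine N.neg_mem (N.add_mem ?_ (N.sum_mem fun p hp => ?_))
    · rw [hunit]
      exact units_smul_mem N _ (hpair m j le_rfl le_rfl)
    · rw [hunit]
      exact units_smul_mem N _ (hpair _ _ (hS p hp).1.le (hS p hp).2.le)
  obtain ⟨c, hc, hsum⟩ := (Finsupp.mem_span_image_iff_linearCombination ℂ).1 hmem
  refine ⟨c, ?_, fun l hl => hc hl⟩
  rw [← hsum, Finsupp.linearCombination_apply]

theorem isStraightenedLawAlgebra_intervalGenerator (d d' : AffineWeight) :
    IsStraightenedLawAlgebra ℂ (intervalGenerator d d') where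
  linearIndependent := by
    have := linearIndependent_standardMonomial (k := ℂ)
      (e := fun t : RelationIndex d d' => pairExponent t.pair) monicQuadric_sub_mem_weightLT
      monicQuadric_overlap not_pairExponent_le_listExponent
    rw [span_monicQuadric] at this
    exact this
  span_eq_top := by
    have := span_standardMonomial_eq_top (k := ℂ)
      (e := fun t : RelationIndex d d' => pairExponent t.pair) monicQuadric_sub_mem_weightLT
      exists_multichain_of_not_pairExponent_le
    rw [span_monicQuadric] at this
    exact this
  straightening α β h₁ h₂ := by
    obtain ⟨t, h⟩ := exists_relationIndex h₁ h₂
    have hrel := isStraighteningRelation_affineQuadric t.2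
    have hmem : affineQuadric d d' t.1.1 t.1.2 ∈ quadricIdeal d d' :=
      Ideal.subset_span ⟨t.1, rfl⟩
    rcases h with h | h
    · obtain ⟨rfl, rfl⟩ := Prod.mk.inj h
      exact hrel.exists_expansion hmem
    · obtain ⟨rfl, rfl⟩ := Prod.mk.inj h
      exact hrel.symm.exists_expansion hmem

theorem corollaryP (d d' : AffineWeight) :
    IsStraightenedLawAlgebra ℂ (intervalGenerator d d') ∧
    (∀ α β : Set.Icc d d', ¬ α ≤ β → ¬ β ≤ α →
      ∃ (s : VectorWeight) (l : ℤ), IsStraighteningRelation (affineQuadric d d' s l) α β) ∧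
    (∀ (s : VectorWeight) (l : ℤ), affineQuadric d d' s l = 0 ∨
      ∃ α β : Set.Icc d d', ¬ α ≤ β ∧ ¬ β ≤ α ∧
        IsStraighteningRelation (affineQuadric d d' s l) α β) := by
  refine ⟨isStraightenedLawAlgebra_intervalGenerator d d', fun α β h₁ h₂ => ?_, fun s l => ?_⟩
  · obtain ⟨t, h⟩ := exists_relationIndex h₁ h₂
    have hrel := isStraighteningRelation_affineQuadric t.2
    refine ⟨t.1.1, t.1.2, ?_⟩
    rcases h with h | h
    · obtain ⟨rfl, rfl⟩ := Prod.mk.inj h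
      exact hrel
    · obtain ⟨rfl, rfl⟩ := Prod.mk.inj h
      exact hrel.symm
  · by_cases h : ClutterMem d d' (s, l)
    · exact Or.inr ⟨⟨_, h.1⟩, ⟨_, h.2⟩, VectorWeight.not_le_clutter s l,
        VectorWeight.not_ge_clutter s l, isStraighteningRelation_affineQuadric h⟩
    · exact Or.inl (affineQuadric_eq_zero h)
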